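/- Let $\widehat R=[-1,1]^2$ and $\widehat{\mathbb P}=P_3(\widehat R)\oplus\mathrm{Span}\{x^3y-xy^3\}$, where $P_3(\widehat R)$ is the space of polynomials of total degree at most $3$ on $\widehat R$. Let $\Omega\subset\mathbb R^2$ be a parallelogram domain (the image of $(-1,1)^2$ under an invertible affine map), and let $\mathcal T_h$ be a finite conforming mesh of $\overline\Omega$ into closed parallelograms: the cells cover $\overline\Omega$, have pairwise disjoint interiors, and any two distinct cells are disjoint, or meet in exactly one common vertex, or meet in exactly one common (whole) edge. For each $R\in\mathcal T_h$ let $F_R$ be an invertible affine map of the plane with $R=F_R(\widehat R)$, and put $\mathbb P_R=\{\hat p\circ F_R^{-1}:\hat p\in\widehat{\mathbb P}\}$. Let $\mathcal V_h$ and $\mathcal E_h$ be the sets of vertices and edges of cells, and $N_V$, $N_E$ their cardinalities. The Gauss points of an edge $E\in\mathcal E_h$ with endpoints $a,b$ are its midpoint $M_E=\frac{a+b}2$ and the two points $\frac{a+b}2\pm\sqrt{3/5}\,\frac{b-a}2$. Let $\mathcal G_h=\{g_1,\dots,g_{N_G}\}$ be the set of all Gauss points of edges, numbered in an arbitrary way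 without repetition. For an edge $E$ whose Gauss points other than $M_E$ are $g_i,g_k$ with $i<k$, write $M_E^+=g_i$, $M_E^-=g_k$. For $V\in\mathcal V_h$ let $\mathcal G_h(V)$ be the set of those Gauss points that are, for some edge $E\in\mathcal E_h$ with endpoint $V$, the one nearest to $V$ among the three Gauss points of $E$. Let $\mathcal{NC}^h$ be the space of piecewise functions $\varphi=(\varphi_R)_{R\in\mathcal T_h}$ with $\varphi_R\in\mathbb P_R$ for every $R$ that are continuous at the Gauss points, i.e. $\varphi_R(g)=\varphi_{R'}(g)$ whenever $g\in\mathcal G_h\cap R\cap R'$. Theorem. $\mathcal{NC}^h$ is finite-dimensional and $\dim\mathcal{NC}^h=N_V+2N_E-1$. For every $V\in\mathcal V_h$ and every $E\in\mathcal E_h$ there are unique functions $\varphi_V,\varphi_E^{+},\varphi_E^{-}\in\mathcal{NC}^h$ such that - $\varphi_V$ equals $1$ at the points of $\mathcal G_h(V)$ and $0$ at all other Gauss points; - $\varphi_E^{\pm}$ equals $5$ at $M_E$, $4$ at $M_E^{\pm}$ and $0$ at all other Gauss points. If any single one of these $N_V+2N_E$ functions is omitted, the remaining ones form a basis of $\mathcal{NC}^h$.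 In particular, for every $V_*\in\mathcal V_h$ and every $E_*\in\mathcal E_h$, each of the sets $$\mathcal B_1=\{\varphi_V:V\ne V_*\}\cup\{\varphi_E^+:E\in\mathcal E_h\}\cup\{\varphi_E^-:E\in\mathcal E_h\},$$ $$\mathcal B_2=\{\varphi_V:V\in\mathcal V_h\}\cup\{\varphi_E^+:E\ne E_*\}\cup\{\varphi_E^-:E\in\mathcal E_h\},$$ $$\mathcal B_3=\{\varphi_V:V\in\mathcal V_h\}\cup\{\varphi_E^+:E\in\mathcal E_h\}\cup\{\varphi_E^-:E\ne E_*\}$$ is a basis of $\mathcal{NC}^h$. -/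

import Mathlib

noncomputable section

namespace CubicNC

/-- The Euclidean plane. -/
abbrev Plane : Type := EuclideanSpace ℝ (Fin 2)

/-- The closed reference square `[-1,1]²`. -/
def refSquare : Set Plane := {x | ∀ k, x k ∈ Set.Icc (-1 : ℝ) 1}

/-- A parallelogram domain: the image of the open square `(-1,1)²` under an invertible affine map. -/
def IsParallelogramDomain (Ω : Set Plane) : Prop :=
  ∃ A : Plane ≃ᵃ[ℝ] Plane, Ω = A '' {x | ∀ k, x k ∈ Set.Ioo (-1 : ℝ) 1}

/-- The four vertices of the reference square, in counterclockwise order. -/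
def refVertex : Fin 4 → Plane :=
  ![!₂[-1, -1], !₂[1, -1], !₂[1, 1], !₂[-1, 1]]

/-- Evaluation of a bivariate polynomial as a function on a set `S` of points. -/
def evalOn (S : Set Plane) : MvPolynomial (Fin 2) ℝ →ₗ[ℝ] (S → ℝ) where
  toFun p := fun x => MvPolynomial.eval (fun k => x.1 k) p
  map_add' p q := by ext x; simp
  map_smul' c p := by ext x; simp

/-- `P_k(S)`: the polynomial functions of total degree at most `k` on `S`. -/
def polyOn (k : ℕ) (S : Set Plane) : Submodule ℝ (S → ℝ) :=
  (MvPolynomial.restrictTotalDegree (Fin 2) ℝ k).map (evalOn S)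

/-- The reference shape function space `P₃ ⊕ Span {x³ y - x y³}` on the reference square. -/
def refSpace : Submodule ℝ (refSquare → ℝ) :=
  polyOn 3 refSquare ⊔
    Submodule.span ℝ {fun x => x.1 0 ^ 3 * x.1 1 - x.1 0 * x.1 1 ^ 3}

/-! ### Edges as segments: endpoints, midpoint, Gauss points -/

/-- The endpoints of a segment `E`. -/
def endpoints (E : Set Plane) : Set Plane := {a | ∃ b, E = segment ℝ a b}

/-- The midpoint of a segment `E` (as a one-point set). -/
def midPts (E : Set Plane) : Set Plane :=
  {g | ∃ a b, E = segment ℝ a b ∧ g = midpoint ℝ a b}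

/-- The two Gauss points of a segment `E` other than the midpoint, at relative distance `√(3/5)`
from the midpoint. Both of them occur, since `a` and `b` may be exchanged. -/
def sideGauss (E : Set Plane) : Set Plane :=
  {g | ∃ a b, E = segment ℝ a b ∧ g = AffineMap.lineMap a b ((1 + √(3 / 5)) / 2)}

/-- The three Gauss points of a segment `E`. -/
def gaussOn (E : Set Plane) : Set Plane := midPts E ∪ sideGauss E

/-! ### Meshes -/

/-- A conforming mesh of a domain `Ω` into parallelograms `F i (refSquare)`, with a choice of the
affine maps from the reference square. -/
structure ParallelogramMesh (Ω : Set Plane) (ι : Type*) where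
  /-- the affine map from the reference square onto the `i`-th cell -/
  F : ι → (Plane ≃ᵃ[ℝ] Plane)
  /-- the cells cover the closed domain -/
  cover : ⋃ i, F i '' refSquare = closure Ω
  /-- distinct cells do not overlap -/
  disjoint_interior : ∀ i j, i ≠ j →
    Disjoint (interior (F i '' refSquare)) (interior (F j '' refSquare))
  /-- two distinct cells are disjoint or share exactly a vertex or exactly a whole edge -/
  conforming : ∀ i j, i ≠ j →
    F i '' refSquare ∩ F j '' refSquare = ∅ ∨
    (∃ k l, F i (refVertex k) = F j (refVertex l) ∧
      F i '' refSquare ∩ F j '' refSquare = {F i (refVertex k)}) ∨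
    (∃ k l, segment ℝ (F i (refVertex k)) (F i (refVertex (k + 1))) =
        segment ℝ (F j (refVertex l)) (F j (refVertex (l + 1))) ∧
      F i '' refSquare ∩ F j '' refSquare =
        segment ℝ (F i (refVertex k)) (F i (refVertex (k + 1))))

namespace ParallelogramMesh

variable {Ω : Set Plane} {ι : Type*} (M : ParallelogramMesh Ω ι)

/-- The closed cell with index `i`. -/
def cell (i : ι) : Set Plane := M.F i '' refSquare

/-- The set of all vertices of cells. -/
def vertices : Set Plane := {v | ∃ i k, v = M.F i (refVertex k)}

/-- The set of all edges of cells; an edge is a closed segment. -/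
def edges : Set (Set Plane) :=
  {E | ∃ i k, E = segment ℝ (M.F i (refVertex k)) (M.F i (refVertex (k + 1)))}

/-- The set of all Gauss points on edges. -/
def gaussPoints : Set Plane := ⋃ E ∈ M.edges, gaussOn E

/-- Number of vertices. -/
def numVertices : ℕ := M.vertices.ncard

/-- Number of edges. -/
def numEdges : ℕ := M.edges.ncard

/-- Number of Gauss points. -/
def numGauss : ℕ := M.gaussPoints.ncard

/-- The inverse of the affine map, from the cell to the reference square. -/
def toRef (i : ι) (x : M.cell i) : refSquare :=
  ⟨(M.F i).symm x.1, by
    obtain ⟨y, hy, hyx⟩ := x.2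
    rw [← hyx]
    simpa using hy⟩

/-- The shape functions on the `i`-th cell: the functions `p ∘ F⁻¹` for `p` in the reference
space. -/
def cellSpace (i : ι) : Submodule ℝ (M.cell i → ℝ) :=
  refSpace.map (LinearMap.funLeft ℝ ℝ (M.toRef i))

/-- The nonconforming space. A piecewise function is given by its restrictions to the closed cells
(across an edge it may be two-valued); each restriction is a shape function, and at every Gauss
point the restrictions to all the cells that contain it have the same value. -/
def NC : Submodule ℝ ((i : ι) → M.cell i → ℝ) where
  carrier := {φ | (∀ i, φ i ∈ M.cellSpace i) ∧
    ∀ g ∈ M.gaussPoints, ∀ i j, ∀ (hi : g ∈ M.cell i) (hj : g ∈ M.cell j),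
      φ i ⟨g, hi⟩ = φ j ⟨g, hj⟩}
  add_mem' := by
    rintro φ ψ ⟨h1, h2⟩ ⟨h3, h4⟩
    refine ⟨fun i => (M.cellSpace i).add_mem (h1 i) (h3 i), fun g hg i j hi hj => ?_⟩
    simp [h2 g hg i j hi hj, h4 g hg i j hi hj]
  zero_mem' := ⟨fun i => (M.cellSpace i).zero_mem, fun _ _ _ _ _ _ => rfl⟩
  smul_mem' := by
    rintro c φ ⟨h1, h2⟩
    refine ⟨fun i => (M.cellSpace i).smul_mem c (h1 i), fun g hg i j hi hj => ?_⟩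
    simp [h2 g hg i j hi hj]

/-- `φ` takes the value `w g` at every Gauss point `g` of the mesh. -/
def HasGaussValues (φ : M.NC) (w : Plane → ℝ) : Prop :=
  ∀ g ∈ M.gaussPoints, ∀ i, ∀ hi : g ∈ M.cell i, φ.1 i ⟨g, hi⟩ = w g

/-- For every edge with endpoint `v`, the Gauss point on that edge that is nearest to `v`. -/
def gaussNear (v : Plane) : Set Plane :=
  {g | ∃ E ∈ M.edges, v ∈ endpoints E ∧ g ∈ gaussOn E ∧ ∀ g' ∈ gaussOn E, dist v g ≤ dist v g'}

/-- For a numbering `γ` of the Gauss points: `g` is the side Gauss point of `E` with the smaller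
number. -/
def IsPlus (γ : Fin M.numGauss ≃ M.gaussPoints) (E : Set Plane) (g : Plane) : Prop :=
  ∃ i k, i < k ∧ sideGauss E = {(γ i).1, (γ k).1} ∧ g = γ i

/-- For a numbering `γ` of the Gauss points: `g` is the side Gauss point of `E` with the larger
number. -/
def IsMinus (γ : Fin M.numGauss ≃ M.gaussPoints) (E : Set Plane) (g : Plane) : Prop :=
  ∃ i k, i < k ∧ sideGauss E = {(γ i).1, (γ k).1} ∧ g = γ k

open Classical in
/-- Gauss values of the function associated with the vertex `v`. -/
def vertexValues (v : Plane) (g : Plane) : ℝ := if g ∈ M.gaussNear v then 1 else 0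

open Classical in
/-- Gauss values of the first function associated with the edge `E`. -/
def plusValues (γ : Fin M.numGauss ≃ M.gaussPoints) (E : Set Plane) (g : Plane) : ℝ :=
  if g ∈ midPts E then 5 else if M.IsPlus γ E g then 4 else 0

open Classical in
/-- Gauss values of the second function associated with the edge `E`. -/
def minusValues (γ : Fin M.numGauss ≃ M.gaussPoints) (E : Set Plane) (g : Plane) : ℝ :=
  if g ∈ midPts E then 5 else if M.IsMinus γ E g then 4 else 0

end ParallelogramMesh

/-- A family of vectors is a basis: linearly independent and spanning. -/
def IsBasisFamily {κ W : Type*} [AddCommGroup W] [Module ℝ W] (b : κ → W) : Prop :=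
  LinearIndependent ℝ b ∧ Submodule.span ℝ (Set.range b) = ⊤

/-- A set of vectors is a basis: linearly independent and spanning. -/
def IsBasisSet {W : Type*} [AddCommGroup W] [Module ℝ W] (B : Set W) : Prop :=
  LinearIndepOn ℝ id B ∧ Submodule.span ℝ B = ⊤

end CubicNC

end

/-! With `s² = 3/5`, every cubic `p` on `[-1,1]` satisfies `5 p(-s) - 4 p(0) + 5 p(s) = 3 (p(-1) +
p(1))`. All shape functions are cubic on the edges of a cell, so the alternating sum around a cell
of these edge functionals vanishes. The shape space has dimension 11 and there are 12 Gauss points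
per cell; as Gauss values determine a shape function (`shape_eq_zero`), this is the only relation
(`exists_shape_of_cellFunctional_eq_zero`). Hence nonconforming functions correspond to Gauss values
on the edges that satisfy one linear condition per cell, and this condition involves only the edge
functionals.

The functions of an edge have zero edge functional on every edge, since `5 * 4 - 4 * 5 = 0`. The
function of a vertex `v` has edge functional 5 on the edges ending at `v` and 0 on the others.
Spanning therefore means that edge data `θ` with vanishing alternating cell sums have the form
`θ(ab) = u(a) + u(b)` for some function `u` on the vertices. In a single cell such a `u` exists and
is fixed by one value. Comparing neighbouring cells at common vertices gives a cocycle of transition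
maps, and a global `u` is a flat section of it. It exists because the closed domain is an injective
continuous image of a square, over which there is no monodromy (`extendsFlat_range_square`,
`IsEdgeData.exists_vertex_values`).

The case `θ = 0` with value 1 at a vertex gives an alternating function; by connectedness, an
alternating function that vanishes at one vertex vanishes at all (`eq_zero_of_alternating`). So the
linear relations among the vertex and edge functions form a line, and a nonzero relation has no zero
coefficient. For this reason any one function may be omitted, and the dimension is one less than the
number of functions (`GraphSystem.isBasisFamily`). -/

noncomputable section

namespace CubicNC

section

open Set Filter Topology unitInterval

/-! ### Flat sections over closed covers -/

section FlatSections

variable {ι X Y : Type*} [TopologicalSpace Y]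

/-- The transition maps `g` of the cover `C` satisfy the cocycle condition. -/
structure IsCocycle (C : ι → Set Y) (g : ι → ι → X → X) : Prop where
  refl : ∀ i c, g i i c = c
  trans : ∀ i j k x, x ∈ C i → x ∈ C j → x ∈ C k → ∀ c, g j k (g i j c) = g i k c

/-- `s` is a flat section over `T`: locally constant in each member of the cover, and compatible
with the transition maps. -/
structure IsFlatSection (C : ι → Set Y) (g : ι → ι → X → X) (T : Set Y) (s : ι → Y → X) :
    Prop where
  locConst : ∀ i, ∀ x ∈ C i ∩ T, ∀ᶠ y in 𝓝 x, y ∈ C i ∩ T → s i y = s i x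
  compat : ∀ x ∈ T, ∀ i j, x ∈ C i → x ∈ C j → s j x = g i j (s i x)

/-- Every value at every point of `T` extends to a flat section over `T`. -/
def ExtendsFlat (C : ι → Set Y) (g : ι → ι → X → X) (T : Set Y) : Prop :=
  ∀ i₀, ∀ x₀ ∈ C i₀ ∩ T, ∀ c, ∃ s, IsFlatSection C g T s ∧ s i₀ x₀ = c

variable {C : ι → Set Y} {g : ι → ι → X → X}

lemma IsFlatSection.mono {S T : Set Y} {s : ι → Y → X} (h : IsFlatSection C g T s) (hST : S ⊆ T) :
    IsFlatSection C g S s where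
  locConst i x hx := by
    filter_upwards [h.locConst i x ⟨hx.1, hST hx.2⟩] with y hy hyS
    exact hy ⟨hyS.1, hST hyS.2⟩
  compat x hx := h.compat x (hST hx)

/-- Each of the finitely many closed members that miss `x` also misses a neighbourhood of `x`. This
is the local input of all continuation arguments below. -/
lemma eventually_mem_cover_imp [Finite ι] (hC : ∀ i, IsClosed (C i)) (x : Y) :
    ∀ᶠ y in 𝓝 x, ∀ i, y ∈ C i → x ∈ C i := by
  rw [eventually_all]
  intro i
  by_cases hx : x ∈ C i
  · exact Eventually.of_forall fun _ _ => hx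
  · filter_upwards [(hC i).isOpen_compl.mem_nhds hx] with y hy hyi
    exact absurd hyi hy

lemma IsFlatSection.eq_of_eq_at {T : Set Y} {s s' : ι → Y → X} (hs : IsFlatSection C g T s)
    (hs' : IsFlatSection C g T s') {x : Y} (hx : x ∈ T) {i j : ι} (hi : x ∈ C i) (hj : x ∈ C j)
    (h : s i x = s' i x) : s j x = s' j x := by
  rw [hs.compat x hx i j hi hj, hs'.compat x hx i j hi hj, h]

/-- Agreement at a point is a locally constant property. Near `a` only members through `a` occur,
both sections are constant on them, and compatibility spreads agreement from one member to all the
others at the same point. -/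
lemma IsFlatSection.eq_on_preconnected [Finite ι] (hC : ∀ i, IsClosed (C i)) {T : Set Y}
    (hT : IsPreconnected T) (hcov : T ⊆ ⋃ i, C i) {s s' : ι → Y → X}
    (hs : IsFlatSection C g T s) (hs' : IsFlatSection C g T s') {x₀ : Y} (hx₀ : x₀ ∈ T) {i₀ : ι}
    (hi₀ : x₀ ∈ C i₀) (h₀ : s i₀ x₀ = s' i₀ x₀) {x : Y} (hx : x ∈ T) {i : ι} (hi : x ∈ C i) :
    s i x = s' i x := by
  have key : (∀ j, x₀ ∈ C j → s j x₀ = s' j x₀) ↔ ∀ j, x ∈ C j → s j x = s' j x := by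
    refine hT.induction₂ (fun a b => (∀ j, a ∈ C j → s j a = s' j a) ↔ ∀ j, b ∈ C j → s j b = s' j b)
      (fun a ha => ?_) (fun _ _ _ _ _ _ h h' => h.trans h') (fun _ _ _ _ h => h.symm) hx₀ hx
    have h1 : ∀ᶠ b in 𝓝 a, ∀ j, a ∈ C j → b ∈ C j ∩ T → s j b = s j a := by
      rw [eventually_all]
      intro j
      by_cases hj : a ∈ C j
      · filter_upwards [hs.locConst j a ⟨hj, ha⟩] with b hb _ using hb
      · exact Eventually.of_forall fun _ h => absurd h hj
    have h2 : ∀ᶠ b in 𝓝 a, ∀ j, a ∈ C j → b ∈ C j ∩ T → s' j b = s' j a := by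
      rw [eventually_all]
      intro j
      by_cases hj : a ∈ C j
      · filter_upwards [hs'.locConst j a ⟨hj, ha⟩] with b hb _ using hb
      · exact Eventually.of_forall fun _ h => absurd h hj
    filter_upwards [nhdsWithin_le_nhds h1, nhdsWithin_le_nhds h2,
      nhdsWithin_le_nhds (eventually_mem_cover_imp hC a), self_mem_nhdsWithin] with b h1 h2 h3 hb
    obtain ⟨k, hk⟩ := mem_iUnion.1 (hcov hb)
    constructor
    · intro h j hj
      rw [h1 j (h3 j hj) ⟨hj, hb⟩, h2 j (h3 j hj) ⟨hj, hb⟩, h j (h3 j hj)]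
    · intro h j hj
      refine hs.eq_of_eq_at hs' ha (h3 k hk) hj ?_
      rw [← h1 k (h3 k hk) ⟨hk, hb⟩, ← h2 k (h3 k hk) ⟨hk, hb⟩, h k hk]
  exact key.1 (fun j hj => hs.eq_of_eq_at hs' hx₀ hi₀ hj h₀) i hi

/-- When all members that meet `T` pass through `p`, the cocycle identity at `p` makes the constants
transported from `i₀` compatible everywhere on `T`. -/
lemma ExtendsFlat.of_common_point (hg : IsCocycle C g) {T : Set Y} {p : Y}
    (hp : ∀ i, ∀ x ∈ T, x ∈ C i → p ∈ C i) : ExtendsFlat C g T := by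
  intro i₀ x₀ hx₀ c
  refine ⟨fun i _ => g i₀ i c, ⟨fun i x _ => Eventually.of_forall fun _ _ => rfl, ?_⟩, hg.refl _ _⟩
  intro x hx i j hi hj
  exact (hg.trans i₀ i j p (hp _ _ hx₀.2 hx₀.1) (hp _ _ hx hi) (hp _ _ hx hj) c).symm

/-- A section over `T₁` is continued into `T₂` from one point of the overlap. Connectedness of the
overlap forces the two sections to agree on all of it, so they glue; closedness of the pieces keeps
the result locally constant. -/
lemma ExtendsFlat.union_aux [Finite ι] (hC : ∀ i, IsClosed (C i))
    {T₁ T₂ : Set Y} (hT₁ : IsClosed T₁) (hT₂ : IsClosed T₂) (hconn : IsConnected (T₁ ∩ T₂))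
    (hcov : T₁ ∩ T₂ ⊆ ⋃ i, C i) (h₁ : ExtendsFlat C g T₁) (h₂ : ExtendsFlat C g T₂)
    {i₀ : ι} {x₀ : Y} (hx₀ : x₀ ∈ C i₀ ∩ T₁) (c : X) :
    ∃ s, IsFlatSection C g (T₁ ∪ T₂) s ∧ s i₀ x₀ = c := by
  classical
  obtain ⟨s, hs, hsc⟩ := h₁ i₀ x₀ hx₀ c
  obtain ⟨y, hy⟩ := hconn.nonempty
  obtain ⟨k, hk⟩ := mem_iUnion.1 (hcov hy)
  obtain ⟨s', hs', hsc'⟩ := h₂ k y ⟨hk, hy.2⟩ (s k y)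
  have hag : ∀ i, ∀ x ∈ T₁ ∩ T₂, x ∈ C i → s i x = s' i x := fun i x hx hi =>
    (hs.mono inter_subset_left).eq_on_preconnected hC hconn.isPreconnected hcov
      (hs'.mono inter_subset_right) hy hk hsc'.symm hx hi
  let r : ι → Y → X := fun i x => if x ∈ T₁ then s i x else s' i x
  have hr₁ : ∀ i, ∀ x ∈ T₁, r i x = s i x := fun i x hx => if_pos hx
  have hr₂ : ∀ i, ∀ x ∈ T₂, x ∈ C i → r i x = s' i x := by
    intro i x hx hi
    by_cases h : x ∈ T₁
    · rw [hr₁ i x h, hag i x ⟨h, hx⟩ hi]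
    · exact if_neg h
  refine ⟨r, ⟨?_, ?_⟩, (hr₁ _ _ hx₀.2).trans hsc⟩
  · rintro i x ⟨hi, hx⟩
    have e₁ : ∀ᶠ z in 𝓝 x, z ∈ C i → z ∈ T₁ → r i z = r i x := by
      by_cases h : x ∈ T₁
      · filter_upwards [hs.locConst i x ⟨hi, h⟩] with z hz hzi hzT
        rw [hr₁ i x h, hr₁ i z hzT, hz ⟨hzi, hzT⟩]
      · filter_upwards [hT₁.isOpen_compl.mem_nhds h] with z hz _ hzT using absurd hzT hz
    have e₂ : ∀ᶠ z in 𝓝 x, z ∈ C i → z ∈ T₂ → r i z = r i x := by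
      by_cases h : x ∈ T₂
      · filter_upwards [hs'.locConst i x ⟨hi, h⟩] with z hz hzi hzT
        rw [hr₂ i x h hi, hr₂ i z hzT hzi, hz ⟨hzi, hzT⟩]
      · filter_upwards [hT₂.isOpen_compl.mem_nhds h] with z hz _ hzT using absurd hzT hz
    filter_upwards [e₁, e₂] with z h1 h2 hz
    exact hz.2.elim (h1 hz.1) (h2 hz.1)
  · rintro x (hx | hx) i j hi hj
    · rw [hr₁ i x hx, hr₁ j x hx, hs.compat x hx i j hi hj]
    · rw [hr₂ i x hx hi, hr₂ j x hx hj, hs'.compat x hx i j hi hj]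

lemma ExtendsFlat.union [Finite ι] (hC : ∀ i, IsClosed (C i))
    {T₁ T₂ : Set Y} (hT₁ : IsClosed T₁) (hT₂ : IsClosed T₂) (hconn : IsConnected (T₁ ∩ T₂))
    (hcov : T₁ ∩ T₂ ⊆ ⋃ i, C i) (h₁ : ExtendsFlat C g T₁) (h₂ : ExtendsFlat C g T₂) :
    ExtendsFlat C g (T₁ ∪ T₂) := by
  rintro i₀ x₀ ⟨hi, hx | hx⟩ c
  · exact ExtendsFlat.union_aux hC hT₁ hT₂ hconn hcov h₁ h₂ ⟨hi, hx⟩ c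
  · rw [union_comm]
    rw [inter_comm] at hconn hcov
    exact ExtendsFlat.union_aux hC hT₂ hT₁ hconn hcov h₂ h₁ ⟨hi, hx⟩ c

/-- Over an injective image of the unit square there is no monodromy. -/
lemma extendsFlat_range_square [Finite ι] [T2Space Y] (hg : IsCocycle C g)
    (hC : ∀ i, IsClosed (C i)) {h : I × I → Y} (hc : Continuous h) (hinj : Function.Injective h)
    (hcov : range h ⊆ ⋃ i, C i) : ExtendsFlat C g (range h) := by
  -- `U p` consists of the parameters whose image lies only in members through `h p`. A grid finer
  -- than this open cover has cells to which `ExtendsFlat.of_common_point` applies.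
  let U : I × I → Set (I × I) := fun p => ⋂ i, {q | h q ∈ C i → h p ∈ C i}
  have hU : ∀ p, IsOpen (U p) := by
    intro p
    refine isOpen_iInter_of_finite fun i => ?_
    by_cases hp : h p ∈ C i
    · simp [hp]
    · simp only [hp, imp_false]
      exact (hC i).isOpen_compl.preimage hc
  obtain ⟨t, t0, tm, ⟨n, tn⟩, ht⟩ := exists_monotone_Icc_subset_open_cover_unitInterval_prod_self hU
    fun p _ => mem_iUnion.2 ⟨p, mem_iInter.2 fun i hi => hi⟩
  have hsmall : ∀ k m, ExtendsFlat C g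
      (h '' (Icc (t k) (t (k + 1)) ×ˢ Icc (t m) (t (m + 1)))) := by
    intro k m
    obtain ⟨p, hp⟩ := ht k m
    refine ExtendsFlat.of_common_point hg (p := h p) ?_
    rintro i _ ⟨q, hq, rfl⟩ hi
    exact mem_iInter.1 (hp hq) i hi
  have hclosed : ∀ a b c d : I, IsClosed (h '' (Icc a b ×ˢ Icc c d)) := fun a b c d =>
    ((isCompact_Icc.prod isCompact_Icc).image hc).isClosed
  have hconn : ∀ a b c d : I, a ≤ b → c ≤ d → IsConnected (h '' (Icc a b ×ˢ Icc c d)) :=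
    fun a b c d hab hcd => ((isConnected_Icc hab).prod (isConnected_Icc hcd)).image _ hc.continuousOn
  -- Consecutive blocks of the grid overlap in a degenerate rectangle, whose image is connected.
  -- Grid cells are joined to rows first, and the rows to the whole square.
  have hIcc : ∀ a b : I, a ≤ b → ∀ z, z ≤ a → Icc z a ∩ Icc a b = Icc a a := by
    intro a b hab z hz
    ext x
    simp only [mem_inter_iff, mem_Icc]
    exact ⟨fun h => ⟨h.2.1, h.1.2⟩, fun h => ⟨⟨hz.trans h.1, h.2⟩, h.1, h.2.trans hab⟩⟩
  have hrow : ∀ m k, ExtendsFlat C g (h '' (Icc (t 0) (t (k + 1)) ×ˢ Icc (t m) (t (m + 1)))) := by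
    intro m k
    induction k with
    | zero => exact hsmall 0 m
    | succ k ih =>
      rw [← Icc_union_Icc_eq_Icc (tm (Nat.zero_le (k + 1))) (tm (Nat.le_succ (k + 1))), union_prod,
        image_union]
      refine ExtendsFlat.union hC (hclosed _ _ _ _) (hclosed _ _ _ _) ?_
        (inter_subset_left.trans ((image_subset_range _ _).trans hcov)) ih (hsmall _ _)
      rw [← image_inter hinj, ← inter_prod, hIcc _ _ (tm (Nat.le_succ _)) _ (tm (Nat.zero_le _))]
      exact hconn _ _ _ _ le_rfl (tm (Nat.le_succ _))
  have hall : ∀ m, ExtendsFlat C g (h '' (Icc (t 0) (t (n + 1)) ×ˢ Icc (t 0) (t (m + 1)))) := by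
    intro m
    induction m with
    | zero => exact hrow 0 n
    | succ m ih =>
      rw [← Icc_union_Icc_eq_Icc (tm (Nat.zero_le (m + 1))) (tm (Nat.le_succ (m + 1))), prod_union,
        image_union]
      refine ExtendsFlat.union hC (hclosed _ _ _ _) (hclosed _ _ _ _) ?_
        (inter_subset_left.trans ((image_subset_range _ _).trans hcov)) ih (hrow _ _)
      rw [← image_inter hinj, ← prod_inter, hIcc _ _ (tm (Nat.le_succ _)) _ (tm (Nat.zero_le _))]
      exact hconn _ _ _ _ (tm (Nat.zero_le _)) le_rfl
  have := hall n
  rw [t0, tn (n + 1) (Nat.le_succ n)] at this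
  have huniv : Icc (0 : I) 1 = univ := Set.eq_univ_of_forall fun x => ⟨x.2.1, x.2.2⟩
  rwa [huniv, univ_prod_univ, image_univ] at this

/-- A cocycle on a cover of a square by preconnected closed sets has a global section through any
given value. -/
lemma IsCocycle.exists_section [Finite ι] [T2Space Y] (hg : IsCocycle C g)
    (hC : ∀ i, IsClosed (C i)) (hpre : ∀ i, IsPreconnected (C i)) (hne : ∀ i, (C i).Nonempty)
    {h : I × I → Y} (hc : Continuous h) (hinj : Function.Injective h)
    (hcov : ⋃ i, C i = range h) (i₀ : ι) (c : X) :
    ∃ s : ι → X, s i₀ = c ∧ ∀ i j x, x ∈ C i → x ∈ C j → s j = g i j (s i) := by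
  have hsub : ∀ i, C i ⊆ range h := fun i => hcov ▸ subset_iUnion C i
  choose p hp using hne
  obtain ⟨s, hs, hs₀⟩ := extendsFlat_range_square hg hC hc hinj hcov.ge i₀ (p i₀)
    ⟨hp i₀, hsub _ (hp i₀)⟩ c
  -- Each member is preconnected, so a flat section is described by one value per member.
  have hconst : ∀ i, ∀ x ∈ C i, s i x = s i (p i) := by
    intro i x hx
    refine (hpre i).induction₂ (fun a b => s i a = s i b) (fun a ha => ?_)
      (fun _ _ _ _ _ _ h h' => h.trans h') (fun _ _ _ _ h => h.symm) hx (hp i)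
    filter_upwards [nhdsWithin_le_nhds (hs.locConst i a ⟨ha, hsub i ha⟩), self_mem_nhdsWithin]
      with b hb hbi
    exact (hb ⟨hbi, hsub i hbi⟩).symm
  refine ⟨fun i => s i (p i), hs₀, fun i j x hi hj => ?_⟩
  beta_reduce
  rw [← hconst i x hi, ← hconst j x hj]
  exact hs.compat x (hsub i hi) i j hi hj

end FlatSections

end

/-! ### The reference cell -/

section Reference

lemma refSquare_mem {x : Plane} :
    x ∈ refSquare ↔ (-1 ≤ x 0 ∧ x 0 ≤ 1) ∧ (-1 ≤ x 1 ∧ x 1 ≤ 1) := by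
  simp [refSquare, Fin.forall_fin_two]

/-- The general shape function of the reference cell. -/
def shape (c : Fin 11 → ℝ) (x : Plane) : ℝ :=
  c 0 + c 1 * x 0 + c 2 * x 1 + c 3 * x 0 ^ 2 + c 4 * (x 0 * x 1) + c 5 * x 1 ^ 2 +
  c 6 * x 0 ^ 3 + c 7 * (x 0 ^ 2 * x 1) + c 8 * (x 0 * x 1 ^ 2) + c 9 * x 1 ^ 3 +
  c 10 * (x 0 ^ 3 * x 1 - x 0 * x 1 ^ 3)

lemma eval_monomial_two (d : Fin 2 →₀ ℕ) (x : Plane) (a : ℝ) :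
    MvPolynomial.eval (fun k => x k) (MvPolynomial.monomial d a) = a * (x 0 ^ d 0 * x 1 ^ d 1) := by
  rw [MvPolynomial.eval_monomial, Finsupp.prod_fintype _ _ (by simp)]
  simp

lemma exists_shape_of_totalDegree_le {p : MvPolynomial (Fin 2) ℝ} (hp : p.totalDegree ≤ 3) :
    ∃ c, ∀ x : Plane, MvPolynomial.eval (fun k => x k) p = shape c x := by
  have hmon : ∀ (d : Fin 2 →₀ ℕ) (a : ℝ), d 0 + d 1 ≤ 3 →
      ∃ c, ∀ x : Plane, MvPolynomial.eval (fun k => x k) (MvPolynomial.monomial d a) = shape c x := by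
    intro d a hd
    simp_rw [eval_monomial_two]
    generalize d 0 = m at *
    generalize d 1 = n at *
    have : (m = 0 ∧ n = 0) ∨ (m = 1 ∧ n = 0) ∨ (m = 0 ∧ n = 1) ∨ (m = 2 ∧ n = 0) ∨
        (m = 1 ∧ n = 1) ∨ (m = 0 ∧ n = 2) ∨ (m = 3 ∧ n = 0) ∨ (m = 2 ∧ n = 1) ∨
        (m = 1 ∧ n = 2) ∨ (m = 0 ∧ n = 3) := by omega
    rcases this with h | h | h | h | h | h | h | h | h | h <;> obtain ⟨rfl, rfl⟩ := h
    · exact ⟨![a, 0, 0, 0, 0, 0, 0, 0, 0, 0, 0], fun x => by simp [shape]⟩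
    · exact ⟨![0, a, 0, 0, 0, 0, 0, 0, 0, 0, 0], fun x => by simp [shape]⟩
    · exact ⟨![0, 0, a, 0, 0, 0, 0, 0, 0, 0, 0], fun x => by simp [shape]⟩
    · exact ⟨![0, 0, 0, a, 0, 0, 0, 0, 0, 0, 0], fun x => by simp [shape]⟩
    · exact ⟨![0, 0, 0, 0, a, 0, 0, 0, 0, 0, 0], fun x => by simp [shape]⟩
    · exact ⟨![0, 0, 0, 0, 0, a, 0, 0, 0, 0, 0], fun x => by simp [shape]⟩
    · exact ⟨![0, 0, 0, 0, 0, 0, a, 0, 0, 0, 0], fun x => by simp [shape]⟩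
    · exact ⟨![0, 0, 0, 0, 0, 0, 0, a, 0, 0, 0], fun x => by simp [shape]⟩
    · exact ⟨![0, 0, 0, 0, 0, 0, 0, 0, a, 0, 0], fun x => by simp [shape]⟩
    · exact ⟨![0, 0, 0, 0, 0, 0, 0, 0, 0, a, 0], fun x => by simp [shape]⟩
  have hsum : ∀ s : Finset (Fin 2 →₀ ℕ), (∀ d ∈ s, d 0 + d 1 ≤ 3) →
      ∃ c, ∀ x : Plane, MvPolynomial.eval (fun k => x k)
        (∑ d ∈ s, MvPolynomial.monomial d (p.coeff d)) = shape c x := by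
    intro s
    induction s using Finset.induction_on with
    | empty => exact fun _ => ⟨0, fun x => by simp [shape]⟩
    | insert d s hd ih =>
      intro h
      obtain ⟨c, hc⟩ := hmon d (p.coeff d) (h d (Finset.mem_insert_self _ _))
      obtain ⟨c', hc'⟩ := ih fun e he => h e (Finset.mem_insert_of_mem he)
      refine ⟨c + c', fun x => ?_⟩
      rw [Finset.sum_insert hd, map_add, hc, hc']
      simp only [shape, Pi.add_apply]
      ring
  obtain ⟨c, hc⟩ := hsum p.support fun d hd => by
    have := (MvPolynomial.le_totalDegree hd).trans hp
    rwa [Finsupp.sum_fintype _ _ (by simp), Fin.sum_univ_two] at this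
  refine ⟨c, fun x => ?_⟩
  rw [← hc x, ← p.as_sum]

lemma mem_refSpace {ψ : refSquare → ℝ} : ψ ∈ refSpace ↔ ∃ c, ∀ x, ψ x = shape c x.1 := by
  rw [refSpace, Submodule.mem_sup]
  constructor
  · rintro ⟨_, ⟨p, hp, rfl⟩, z, hz, rfl⟩
    obtain ⟨a, rfl⟩ := Submodule.mem_span_singleton.1 hz
    obtain ⟨c, hc⟩ := exists_shape_of_totalDegree_le
      ((MvPolynomial.mem_restrictTotalDegree _ _ _).1 hp)
    refine ⟨c + Pi.single 10 a, fun x => ?_⟩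
    have : evalOn refSquare p x = shape c x.1 := hc x.1
    simp only [Pi.add_apply, this, Pi.smul_apply, smul_eq_mul]
    simp [shape]
    ring
  · rintro ⟨c, hc⟩
    open MvPolynomial in
    let q : MvPolynomial (Fin 2) ℝ := C (c 0) + C (c 1) * X 0 + C (c 2) * X 1 + C (c 3) * X 0 ^ 2 +
      C (c 4) * (X 0 * X 1) + C (c 5) * X 1 ^ 2 + C (c 6) * X 0 ^ 3 + C (c 7) * (X 0 ^ 2 * X 1) +
      C (c 8) * (X 0 * X 1 ^ 2) + C (c 9) * X 1 ^ 3
    refine ⟨evalOn refSquare q, ⟨q, ?_, rfl⟩, _,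
      Submodule.smul_mem _ (c 10) (Submodule.mem_span_singleton_self _), ?_⟩
    · have h1 : ∀ (a : ℝ) (m n : ℕ), m + n ≤ 3 →
          MvPolynomial.C a * (MvPolynomial.X 0 ^ m * MvPolynomial.X 1 ^ n) ∈
          MvPolynomial.restrictTotalDegree (Fin 2) ℝ 3 := by
        intro a m n hmn
        rw [MvPolynomial.mem_restrictTotalDegree]
        refine (MvPolynomial.totalDegree_mul _ _).trans ?_
        rw [MvPolynomial.totalDegree_C, zero_add]
        refine (MvPolynomial.totalDegree_mul _ _).trans ?_
        rwa [MvPolynomial.totalDegree_X_pow, MvPolynomial.totalDegree_X_pow]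
      have h0 := h1 (c 0) 0 0 (by norm_num)
      have h10 := h1 (c 1) 1 0 (by norm_num)
      have h01 := h1 (c 2) 0 1 (by norm_num)
      have h20 := h1 (c 3) 2 0 (by norm_num)
      have h11 := h1 (c 4) 1 1 (by norm_num)
      have h02 := h1 (c 5) 0 2 (by norm_num)
      have h30 := h1 (c 6) 3 0 (by norm_num)
      have h21 := h1 (c 7) 2 1 (by norm_num)
      have h12 := h1 (c 8) 1 2 (by norm_num)
      have h03 := h1 (c 9) 0 3 (by norm_num)
      simp only [pow_zero, pow_one, mul_one, one_mul] at h0 h10 h01 h20 h11 h02 h30 h21 h12 h03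
      exact add_mem (add_mem (add_mem (add_mem (add_mem (add_mem (add_mem (add_mem (add_mem h0 h10)
        h01) h20) h11) h02) h30) h21) h12) h03
    · ext x
      rw [hc]
      simp [evalOn, q, shape]

/-- The positions of the Gauss points on a segment. -/
def gaussNode : Fin 3 → ℝ := ![(1 - √(3 / 5)) / 2, 1 / 2, (1 + √(3 / 5)) / 2]

/-- The Gauss points on the edges of the reference square. -/
def refGauss (k : Fin 4) (m : Fin 3) : Plane :=
  AffineMap.lineMap (refVertex k) (refVertex (k + 1)) (gaussNode m)

/-- Five times the sum of the end values, expressed by Gauss values, of a cubic. -/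
def edgeFunctional (w : Fin 3 → ℝ) : ℝ := 5 * w 0 - 4 * w 1 + 5 * w 2

/-- The alternating sum of the edge functionals. -/
def cellFunctional (w : Fin 4 → Fin 3 → ℝ) : ℝ :=
  edgeFunctional (w 0) - edgeFunctional (w 1) + edgeFunctional (w 2) - edgeFunctional (w 3)

lemma sqrt_sq : √(3 / 5 : ℝ) ^ 2 = 3 / 5 := Real.sq_sqrt (by norm_num)

lemma sqrt_pos : 0 < √(3 / 5 : ℝ) := Real.sqrt_pos.2 (by norm_num)

lemma sqrt_lt : √(3 / 5 : ℝ) < 1 := by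
  rw [Real.sqrt_lt' one_pos]; norm_num

lemma refGauss_apply (k : Fin 4) (m : Fin 3) (j : Fin 2) :
    refGauss k m j = (1 - gaussNode m) * refVertex k j + gaussNode m * refVertex (k + 1) j := by
  simp [refGauss, AffineMap.lineMap_apply_module]

lemma refGauss_coords :
    (refGauss 0 0 0 = -√(3 / 5) ∧ refGauss 0 0 1 = -1) ∧
    (refGauss 0 1 0 = 0 ∧ refGauss 0 1 1 = -1) ∧
    (refGauss 0 2 0 = √(3 / 5) ∧ refGauss 0 2 1 = -1) ∧
    (refGauss 1 0 0 = 1 ∧ refGauss 1 0 1 = -√(3 / 5)) ∧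
    (refGauss 1 1 0 = 1 ∧ refGauss 1 1 1 = 0) ∧
    (refGauss 1 2 0 = 1 ∧ refGauss 1 2 1 = √(3 / 5)) ∧
    (refGauss 2 0 0 = √(3 / 5) ∧ refGauss 2 0 1 = 1) ∧
    (refGauss 2 1 0 = 0 ∧ refGauss 2 1 1 = 1) ∧
    (refGauss 2 2 0 = -√(3 / 5) ∧ refGauss 2 2 1 = 1) ∧
    (refGauss 3 0 0 = -1 ∧ refGauss 3 0 1 = √(3 / 5)) ∧
    (refGauss 3 1 0 = -1 ∧ refGauss 3 1 1 = 0) ∧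
    (refGauss 3 2 0 = -1 ∧ refGauss 3 2 1 = -√(3 / 5)) := by
  simp only [refGauss_apply]
  refine ⟨⟨?_, ?_⟩, ⟨?_, ?_⟩, ⟨?_, ?_⟩, ⟨?_, ?_⟩, ⟨?_, ?_⟩, ⟨?_, ?_⟩, ⟨?_, ?_⟩, ⟨?_, ?_⟩, ⟨?_, ?_⟩,
    ⟨?_, ?_⟩, ⟨?_, ?_⟩, ⟨?_, ?_⟩⟩ <;>
    simp [refVertex, gaussNode, show (1 : Fin 4) + 1 = 2 from rfl,
      show (2 : Fin 4) + 1 = 3 from rfl, show (3 : Fin 4) + 1 = 0 from rfl] <;> ring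

/-- Each edge functional is a multiple of the sum of the two vertex values, and these sums cancel
alternately around the cell. In coefficients only `x²` and `y²` leave a remainder, which is killed
by `s² = 3/5`. -/
lemma cellFunctional_shape (c : Fin 11 → ℝ) :
    cellFunctional (fun k m => shape c (refGauss k m)) = 0 := by
  obtain ⟨⟨a1, b1⟩, ⟨a2, b2⟩, ⟨a3, b3⟩, ⟨a4, b4⟩, ⟨a5, b5⟩, ⟨a6, b6⟩, ⟨a7, b7⟩, ⟨a8, b8⟩, ⟨a9, b9⟩,
    ⟨a10, b10⟩, ⟨a11, b11⟩, ⟨a12, b12⟩⟩ := refGauss_coords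
  simp only [cellFunctional, edgeFunctional, shape, a1, a2, a3, a4, a5, a6, a7, a8, a9, a10, a11,
    a12, b1, b2, b3, b4, b5, b6, b7, b8, b9, b10, b11, b12]
  linear_combination 20 * (c 3 - c 5) * sqrt_sq

lemma shape_eq_zero {c : Fin 11 → ℝ} (h : ∀ k m, shape c (refGauss k m) = 0) : c = 0 := by
  obtain ⟨⟨a1, b1⟩, ⟨a2, b2⟩, ⟨a3, b3⟩, ⟨a4, b4⟩, ⟨a5, b5⟩, ⟨a6, b6⟩, ⟨a7, b7⟩, ⟨a8, b8⟩, ⟨a9, b9⟩,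
    ⟨a10, b10⟩, ⟨a11, b11⟩, ⟨a12, b12⟩⟩ := refGauss_coords
  have h1 := h 0 0
  have h2 := h 0 1
  have h3 := h 0 2
  have h4 := h 1 0
  have h5 := h 1 1
  have h6 := h 1 2
  have h7 := h 2 0
  have h8 := h 2 1
  have h9 := h 2 2
  have h10 := h 3 0
  have h11 := h 3 1
  have h12 := h 3 2
  simp only [shape, a1, a2, a3, a4, a5, a6, a7, a8, a9, a10, a11,
    a12, b1, b2, b3, b4, b5, b6, b7, b8, b9, b10, b11, b12] at h1 h2 h3 h4 h5 h6 h7 h8 h9 h10 h11 h12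
  have hs := sqrt_sq
  have hp := sqrt_pos.ne'
  generalize √(3 / 5) = s at *
  have hs3 : s ^ 3 = 3 / 5 * s := by rw [pow_succ, hs]
  -- Symmetrizing over reflections separates the monomials by their parities in `x` and `y`, leaving
  -- the small systems for `{1, x², y²}`, `{x, x³, xy²}`, `{y, y³, x²y}` and `{xy, x³y - xy³}`.
  -- Equations odd in `s` are divided by `s`.
  have e1 : c 0 + c 3 = 0 := by linear_combination (h5 + h11) / 2
  have e2 : c 0 + c 5 = 0 := by linear_combination (h2 + h8) / 2
  have e3 : c 0 + c 3 + 3 / 5 * c 5 = 0 := by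
    linear_combination (h4 + h6 + h10 + h12) / 4 - c 5 * hs
  have e4 : c 1 + c 6 = 0 := by linear_combination (h5 - h11) / 2
  have e5 : c 1 + c 6 + 3 / 5 * c 8 = 0 := by
    linear_combination (h6 + h4 - h10 - h12) / 4 - c 8 * hs
  have e6 : c 1 + 3 / 5 * c 6 + c 8 = 0 := mul_left_cancel₀ hp (by
    linear_combination (h3 + h7 - h1 - h9) / 4 - c 6 * hs3)
  have e7 : c 2 + c 9 = 0 := by linear_combination (h8 - h2) / 2
  have e8 : c 2 + c 9 + 3 / 5 * c 7 = 0 := by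
    linear_combination (h7 + h9 - h1 - h3) / 4 - c 7 * hs
  have e9 : c 2 + 3 / 5 * c 9 + c 7 = 0 := mul_left_cancel₀ hp (by
    linear_combination (h6 + h10 - h4 - h12) / 4 - c 9 * hs3)
  have e10 : c 4 + 2 / 5 * c 10 = 0 := mul_left_cancel₀ hp (by
    linear_combination (h6 - h4 - h10 + h12) / 4 + c 10 * hs3)
  have e11 : c 4 - 2 / 5 * c 10 = 0 := mul_left_cancel₀ hp (by
    linear_combination (h7 - h9 - h3 + h1) / 4 - c 10 * hs3)
  ext k
  fin_cases k <;> simp <;> linarith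

lemma cellFunctional_add (w w' : Fin 4 → Fin 3 → ℝ) :
    cellFunctional (w + w') = cellFunctional w + cellFunctional w' := by
  simp only [cellFunctional, edgeFunctional, Pi.add_apply]
  ring

lemma cellFunctional_smul (a : ℝ) (w : Fin 4 → Fin 3 → ℝ) :
    cellFunctional (a • w) = a * cellFunctional w := by
  simp only [cellFunctional, edgeFunctional, Pi.smul_apply, smul_eq_mul]
  ring

/-- The coefficient vector of the cell functional. -/
def cellVector : Fin 4 → Fin 3 → ℝ :=
  ![![5, -4, 5], ![-5, 4, -5], ![5, -4, 5], ![-5, 4, -5]]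

lemma cellFunctional_cellVector : cellFunctional cellVector = 264 := by
  simp [cellFunctional, edgeFunctional, cellVector]
  norm_num

/-- Dimension count: adjoining `cellVector`, on which the functional is nonzero, to the 11
coefficients gives an injective map between spaces of dimension 12. It is therefore surjective, and
a vanishing functional forces the extra coordinate to be zero. -/
lemma exists_shape_of_cellFunctional_eq_zero {w : Fin 4 → Fin 3 → ℝ} (hw : cellFunctional w = 0) :
    ∃ c, ∀ k m, shape c (refGauss k m) = w k m := by
  let L : (Fin 11 → ℝ) × ℝ →ₗ[ℝ] (Fin 4 → Fin 3 → ℝ) :=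
    { toFun p := (fun k m => shape p.1 (refGauss k m)) + p.2 • cellVector
      map_add' p q := by
        ext k m
        simp only [shape, Pi.add_apply, Prod.fst_add, Prod.snd_add, Pi.smul_apply, smul_eq_mul]
        ring
      map_smul' a p := by
        ext k m
        simp only [shape, Pi.add_apply, Prod.smul_fst, Prod.smul_snd, Pi.smul_apply, smul_eq_mul,
          RingHom.id_apply]
        ring }
  have hL : ∀ p, cellFunctional (L p) = 264 * p.2 := by
    intro p
    change cellFunctional ((fun k m => shape p.1 (refGauss k m)) + p.2 • cellVector) = _
    rw [cellFunctional_add, cellFunctional_shape, cellFunctional_smul, cellFunctional_cellVector]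
    ring
  have hker : ∀ p, L p = 0 → p = 0 := by
    intro p hp
    have h2 : p.2 = 0 := by
      have := hL p
      rw [hp] at this
      simp [cellFunctional, edgeFunctional] at this
      exact this
    have h1 : p.1 = 0 := shape_eq_zero fun k m => by
      have : L p k m = shape p.1 (refGauss k m) + p.2 * cellVector k m := rfl
      rw [hp, h2] at this
      simpa using this.symm
    exact Prod.ext h1 h2
  have hinj : Function.Injective L := (injective_iff_map_eq_zero L).2 hker
  have hsurj : Function.Surjective L := (LinearMap.injective_iff_surjective_of_finrank_eq_finrank
    (by simp [Module.finrank_pi_fintype])).1 hinj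
  obtain ⟨p, rfl⟩ := hsurj w
  have h2 : p.2 = 0 := by simpa [hw] using hL p
  refine ⟨p.1, fun k m => ?_⟩
  have : L p k m = shape p.1 (refGauss k m) + p.2 * cellVector k m := rfl
  rw [this, h2, zero_mul, add_zero]

end Reference

/-! ### Segments -/

lemma mem_segment_lineMap {a b x : Plane} :
    x ∈ segment ℝ a b ↔ ∃ t ∈ Set.Icc (0 : ℝ) 1, AffineMap.lineMap a b t = x := by
  rw [segment_eq_image_lineMap]; rfl

lemma segment_eq_segment {a b c d : Plane} (h : segment ℝ a b = segment ℝ c d) :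
    (a = c ∧ b = d) ∨ (a = d ∧ b = c) := by
  by_cases hab : a = b
  · subst hab
    rw [segment_same] at h
    have hc : c ∈ ({a} : Set Plane) := h ▸ left_mem_segment ℝ c d
    have hd : d ∈ ({a} : Set Plane) := h ▸ right_mem_segment ℝ c d
    exact Or.inl ⟨hc.symm, hd.symm⟩
  · obtain ⟨t, ht, rfl⟩ := mem_segment_lineMap.1 (h ▸ left_mem_segment ℝ c d : c ∈ segment ℝ a b)
    obtain ⟨u, hu, rfl⟩ := mem_segment_lineMap.1 (h ▸ right_mem_segment ℝ _ d : d ∈ segment ℝ a b)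
    obtain ⟨r, hr, hra⟩ := mem_segment_lineMap.1 (h ▸ left_mem_segment ℝ a b)
    obtain ⟨q, hq, hqb⟩ := mem_segment_lineMap.1 (h ▸ right_mem_segment ℝ a b)
    have hinj := AffineMap.lineMap_injective ℝ hab
    rw [← AffineMap.apply_lineMap] at hra hqb
    have e0 : AffineMap.lineMap t u r = (0 : ℝ) := hinj (by rw [hra, AffineMap.lineMap_apply_zero])
    have e1 : AffineMap.lineMap t u q = (1 : ℝ) := hinj (by rw [hqb, AffineMap.lineMap_apply_one])
    rw [AffineMap.lineMap_apply_ring] at e0 e1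
    -- Both 0 and 1 are convex combinations of `t` and `u` in `[0,1]`; as extreme points they must
    -- themselves be `t` and `u` in some order.
    have htu : (t = 0 ∧ u = 1) ∨ (t = 1 ∧ u = 0) := by
      obtain ⟨ht0, ht1⟩ := ht
      obtain ⟨hu0, hu1⟩ := hu
      obtain ⟨hr0, hr1⟩ := hr
      obtain ⟨hq0, hq1⟩ := hq
      have f0 : (1 - r) * t = 0 := by nlinarith [mul_nonneg (sub_nonneg.2 hr1) ht0, mul_nonneg hr0 hu0]
      have f1 : r * u = 0 := by nlinarith [mul_nonneg (sub_nonneg.2 hr1) ht0, mul_nonneg hr0 hu0]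
      have g0 : (1 - q) * (1 - t) = 0 := by
        nlinarith [mul_nonneg (sub_nonneg.2 hq1) (sub_nonneg.2 ht1), mul_nonneg hq0 (sub_nonneg.2 hu1)]
      have g1 : q * (1 - u) = 0 := by
        nlinarith [mul_nonneg (sub_nonneg.2 hq1) (sub_nonneg.2 ht1), mul_nonneg hq0 (sub_nonneg.2 hu1)]
      rcases mul_eq_zero.1 f0 with hr | ht
      · have hu : u = 0 := by
          have : r = 1 := by linarith
          simpa [this] using f1
        have : q = 0 := by simpa [hu] using g1
        right
        refine ⟨?_, hu⟩
        rw [this] at g0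
        linarith
      · have : q = 1 := by rw [ht] at g0; linarith
        left
        refine ⟨ht, ?_⟩
        rw [this] at g1
        linarith
    rcases htu with ⟨rfl, rfl⟩ | ⟨rfl, rfl⟩ <;> simp

/-! ### Incidences in the reference square -/

lemma refVertex_coords :
    (refVertex 0 0 = -1 ∧ refVertex 0 1 = -1) ∧ (refVertex 1 0 = 1 ∧ refVertex 1 1 = -1) ∧
    (refVertex 2 0 = 1 ∧ refVertex 2 1 = 1) ∧ (refVertex 3 0 = -1 ∧ refVertex 3 1 = 1) := by
  simp [refVertex]

lemma fin_four_cases (k : Fin 4) : k = 0 ∨ k = 1 ∨ k = 2 ∨ k = 3 := by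
  revert k; decide

lemma plane_ext {x y : Plane} (h0 : x 0 = y 0) (h1 : x 1 = y 1) : x = y := by
  ext k
  fin_cases k
  · exact h0
  · exact h1

lemma convex_refSquare : Convex ℝ refSquare := by
  intro x hx y hy a b ha hb hab k
  have := convex_Icc (-1 : ℝ) 1 (hx k) (hy k) ha hb hab
  simpa using this

lemma refVertex_mem (k : Fin 4) : refVertex k ∈ refSquare := by
  rw [refSquare_mem]
  fin_cases k <;> simp [refVertex]

lemma refVertex_injective : Function.Injective refVertex := by
  obtain ⟨⟨a0, b0⟩, ⟨a1, b1⟩, ⟨a2, b2⟩, ⟨a3, b3⟩⟩ := refVertex_coords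
  intro k l h
  have h0 : refVertex k 0 = refVertex l 0 := by rw [h]
  have h1 : refVertex k 1 = refVertex l 1 := by rw [h]
  rcases fin_four_cases k with rfl | rfl | rfl | rfl <;>
    rcases fin_four_cases l with rfl | rfl | rfl | rfl <;>
    first
    | rfl
    | (exfalso; linarith)

/-- The edges of the reference square. -/
def refEdge (k : Fin 4) : Set Plane := segment ℝ (refVertex k) (refVertex (k + 1))

lemma refEdge_subset (k : Fin 4) : refEdge k ⊆ refSquare :=
  convex_refSquare.segment_subset (refVertex_mem _) (refVertex_mem _)

lemma coord_of_mem_segment {a b x : Plane} (hx : x ∈ segment ℝ a b) {j : Fin 2} {c : ℝ}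
    (ha : a j = c) (hb : b j = c) : x j = c := by
  obtain ⟨s, t, _, _, hst, rfl⟩ := hx
  simp only [PiLp.add_apply, PiLp.smul_apply, smul_eq_mul, ha, hb]
  rw [← add_mul, hst, one_mul]

lemma refEdge_coord {x : Plane} :
    (x ∈ refEdge 0 → x 1 = -1) ∧ (x ∈ refEdge 1 → x 0 = 1) ∧ (x ∈ refEdge 2 → x 1 = 1) ∧
    (x ∈ refEdge 3 → x 0 = -1) := by
  obtain ⟨⟨a0, b0⟩, ⟨a1, b1⟩, ⟨a2, b2⟩, ⟨a3, b3⟩⟩ := refVertex_coords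
  exact ⟨fun h => coord_of_mem_segment h b0 b1, fun h => coord_of_mem_segment h a1 a2,
    fun h => coord_of_mem_segment h b2 b3, fun h => coord_of_mem_segment h a3 a0⟩

lemma refEdge_inter {x : Plane} {k l : Fin 4} (hk : x ∈ refEdge k) (hl : x ∈ refEdge l) :
    k = l ∨ ∃ j, x = refVertex j := by
  obtain ⟨⟨a0, b0⟩, ⟨a1, b1⟩, ⟨a2, b2⟩, ⟨a3, b3⟩⟩ := refVertex_coords
  obtain ⟨e0, e1, e2, e3⟩ := refEdge_coord (x := x)
  have key : ∀ j : Fin 4, (x 0 = refVertex j 0) → x 1 = refVertex j 1 → ∃ j, x = refVertex j :=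
    fun j h0 h1 => ⟨j, plane_ext h0 h1⟩
  have k0 := key 0
  have k1 := key 1
  have k2 := key 2
  have k3 := key 3
  rw [a0, b0] at k0
  rw [a1, b1] at k1
  rw [a2, b2] at k2
  rw [a3, b3] at k3
  rcases fin_four_cases k with rfl | rfl | rfl | rfl <;>
    rcases fin_four_cases l with rfl | rfl | rfl | rfl <;>
    first
    | exact Or.inl rfl
    | exact Or.inr (k0 (e3 hk) (e0 hl))
    | exact Or.inr (k0 (e3 hl) (e0 hk))
    | exact Or.inr (k1 (e1 hk) (e0 hl))
    | exact Or.inr (k1 (e1 hl) (e0 hk))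
    | exact Or.inr (k2 (e1 hk) (e2 hl))
    | exact Or.inr (k2 (e1 hl) (e2 hk))
    | exact Or.inr (k3 (e3 hk) (e2 hl))
    | exact Or.inr (k3 (e3 hl) (e2 hk))
    | (exfalso; have := e0 hk; have := e2 hl; linarith)
    | (exfalso; have := e0 hl; have := e2 hk; linarith)
    | (exfalso; have := e1 hk; have := e3 hl; linarith)
    | (exfalso; have := e1 hl; have := e3 hk; linarith)

lemma eq_of_refVertex_mem_refEdge {j k : Fin 4} (h : refVertex j ∈ refEdge k) :
    j = k ∨ j = k + 1 := by
  obtain ⟨⟨a0, b0⟩, ⟨a1, b1⟩, ⟨a2, b2⟩, ⟨a3, b3⟩⟩ := refVertex_coords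
  obtain ⟨e0, e1, e2, e3⟩ := refEdge_coord (x := refVertex j)
  rcases fin_four_cases k with rfl | rfl | rfl | rfl <;>
    rcases fin_four_cases j with rfl | rfl | rfl | rfl <;>
    first
    | exact Or.inl rfl
    | exact Or.inr rfl
    | (exfalso; have := e0 h; linarith)
    | (exfalso; have := e1 h; linarith)
    | (exfalso; have := e2 h; linarith)
    | (exfalso; have := e3 h; linarith)

lemma gaussNode_zero : gaussNode 0 = (1 - √(3 / 5)) / 2 := rfl

lemma gaussNode_one : gaussNode 1 = 1 / 2 := rfl

lemma gaussNode_two : gaussNode 2 = (1 + √(3 / 5)) / 2 := rfl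

lemma fin_three_cases (m : Fin 3) : m = 0 ∨ m = 1 ∨ m = 2 := by
  revert m; decide

lemma gaussNode_mem (m : Fin 3) : 0 < gaussNode m ∧ gaussNode m < 1 := by
  have := sqrt_pos
  have := sqrt_lt
  rcases fin_three_cases m with rfl | rfl | rfl <;>
    simp only [gaussNode_zero, gaussNode_one, gaussNode_two] <;> constructor <;> linarith

lemma gaussNode_injective : Function.Injective gaussNode := by
  have := sqrt_pos
  intro m n h
  rcases fin_three_cases m with rfl | rfl | rfl <;>
    rcases fin_three_cases n with rfl | rfl | rfl <;>
    first
    | rfl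
    | (exfalso; simp only [gaussNode_zero, gaussNode_one, gaussNode_two] at h; linarith)

lemma refGauss_mem (k : Fin 4) (m : Fin 3) : refGauss k m ∈ refEdge k :=
  mem_segment_lineMap.2 ⟨_, ⟨(gaussNode_mem m).1.le, (gaussNode_mem m).2.le⟩, rfl⟩

lemma lineMap_gaussNode_ne {a b : Plane} (hab : a ≠ b) (m : Fin 3) :
    AffineMap.lineMap a b (gaussNode m) ≠ a ∧ AffineMap.lineMap a b (gaussNode m) ≠ b := by
  simp only [ne_eq, AffineMap.lineMap_eq_left_iff, AffineMap.lineMap_eq_right_iff, hab, false_or]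
  exact ⟨(gaussNode_mem m).1.ne', (gaussNode_mem m).2.ne⟩

lemma refGauss_ne (k : Fin 4) (m : Fin 3) (j : Fin 4) : refGauss k m ≠ refVertex j := by
  intro h
  have hne : refVertex k ≠ refVertex (k + 1) := fun h => by
    simpa using refVertex_injective h
  obtain ⟨h1, h2⟩ := lineMap_gaussNode_ne hne m
  rcases eq_of_refVertex_mem_refEdge (h ▸ refGauss_mem k m) with rfl | rfl
  · exact h1 h
  · exact h2 h

/-! ### Incidences in the mesh -/

namespace ParallelogramMesh

variable {Ω : Set Plane} {ι : Type*} (M : ParallelogramMesh Ω ι)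

/-- The `k`-th vertex of the `i`-th cell. -/
def vert (i : ι) (k : Fin 4) : Plane := M.F i (refVertex k)

/-- The `k`-th edge of the `i`-th cell. -/
def edge (i : ι) (k : Fin 4) : Set Plane := segment ℝ (M.vert i k) (M.vert i (k + 1))

/-- The `m`-th Gauss point of the `k`-th edge of the `i`-th cell. -/
def gauss (i : ι) (k : Fin 4) (m : Fin 3) : Plane := M.F i (refGauss k m)

lemma gauss_eq (i : ι) (k : Fin 4) (m : Fin 3) :
    M.gauss i k m = AffineMap.lineMap (M.vert i k) (M.vert i (k + 1)) (gaussNode m) :=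
  AffineMap.apply_lineMap (M.F i).toAffineMap _ _ _

lemma edge_eq_image (i : ι) (k : Fin 4) : M.edge i k = M.F i '' refEdge k :=
  (image_segment ℝ (M.F i).toAffineMap _ _).symm

lemma vert_mem_vertices (i : ι) (k : Fin 4) : M.vert i k ∈ M.vertices := ⟨i, k, rfl⟩

lemma edge_mem_edges (i : ι) (k : Fin 4) : M.edge i k ∈ M.edges := ⟨i, k, rfl⟩

lemma vert_mem_cell (i : ι) (k : Fin 4) : M.vert i k ∈ M.cell i := ⟨_, refVertex_mem k, rfl⟩

lemma edge_subset_cell (i : ι) (k : Fin 4) : M.edge i k ⊆ M.cell i := by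
  rw [edge_eq_image]
  exact Set.image_mono (refEdge_subset k)

lemma vert_injective (i : ι) : Function.Injective (M.vert i) :=
  (M.F i).injective.comp refVertex_injective

lemma vert_ne_succ (i : ι) (k : Fin 4) : M.vert i k ≠ M.vert i (k + 1) := fun h => by
  simpa using M.vert_injective i h

lemma edge_inter {x : Plane} {i : ι} {k l : Fin 4} (hk : x ∈ M.edge i k) (hl : x ∈ M.edge i l) :
    k = l ∨ ∃ j, x = M.vert i j := by
  rw [edge_eq_image] at hk hl
  obtain ⟨y, hy, rfl⟩ := hk
  rw [(M.F i).injective.mem_set_image] at hl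
  exact (refEdge_inter hy hl).imp_right fun ⟨j, hj⟩ => ⟨j, by rw [hj]; rfl⟩

lemma eq_of_vert_mem_edge {i : ι} {j k : Fin 4} (h : M.vert i j ∈ M.edge i k) :
    j = k ∨ j = k + 1 := by
  rw [edge_eq_image, vert, (M.F i).injective.mem_set_image] at h
  exact eq_of_refVertex_mem_refEdge h

lemma inter_cases {i j : ι} (hij : i ≠ j) {x : Plane} (hi : x ∈ M.cell i) (hj : x ∈ M.cell j) :
    (∃ k l, M.vert i k = M.vert j l ∧ M.cell i ∩ M.cell j = {M.vert i k}) ∨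
    (∃ k l, M.edge i k = M.edge j l ∧ M.cell i ∩ M.cell j = M.edge i k) := by
  rcases M.conforming i j hij with h | h
  · exact absurd (h ▸ ⟨hi, hj⟩ : x ∈ (∅ : Set Plane)) (Set.notMem_empty x)
  · exact h

/-- There are no hanging nodes: a cell meets another one only in a vertex or an edge common to both,
and the ends of a common edge are vertices of both. -/
lemma exists_vert_eq {x : Plane} (hx : x ∈ M.vertices) {i : ι} (hi : x ∈ M.cell i) :
    ∃ k, x = M.vert i k := by
  obtain ⟨j, l, rfl⟩ := hx
  change M.vert j l ∈ M.cell i at hi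
  change ∃ k, M.vert j l = M.vert i k
  by_cases hij : j = i
  · subst hij; exact ⟨l, rfl⟩
  rcases M.inter_cases hij (M.vert_mem_cell j l) hi with ⟨k, l', h, h'⟩ | ⟨k, l', h, h'⟩
  · have : M.vert j l ∈ ({M.vert j k} : Set Plane) := h' ▸ ⟨M.vert_mem_cell j l, hi⟩
    exact ⟨l', this.trans h⟩
  · have : M.vert j l ∈ M.edge j k := h' ▸ ⟨M.vert_mem_cell j l, hi⟩
    rcases M.eq_of_vert_mem_edge this with rfl | rfl <;>
      rcases segment_eq_segment h with ⟨h1, h2⟩ | ⟨h1, h2⟩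
    exacts [⟨_, h1⟩, ⟨_, h1⟩, ⟨_, h2⟩, ⟨_, h2⟩]

lemma exists_edge_eq {x : Plane} (hx : x ∉ M.vertices) {j : ι} {l : Fin 4} (hj : x ∈ M.edge j l)
    {i : ι} (hi : x ∈ M.cell i) : ∃ k, M.edge j l = M.edge i k := by
  by_cases hij : j = i
  · subst hij; exact ⟨l, rfl⟩
  rcases M.inter_cases hij (M.edge_subset_cell j l hj) hi with ⟨k, l', h, h'⟩ | ⟨k, l', h, h'⟩
  · have : x ∈ ({M.vert j k} : Set Plane) := h' ▸ ⟨M.edge_subset_cell j l hj, hi⟩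
    exact absurd (this ▸ M.vert_mem_vertices j k) hx
  · have : x ∈ M.edge j k := h' ▸ ⟨M.edge_subset_cell j l hj, hi⟩
    rcases M.edge_inter hj this with rfl | ⟨m, rfl⟩
    · exact ⟨l', h⟩
    · exact absurd (M.vert_mem_vertices j m) hx

lemma exists_common_vertex₂ {x : Plane} {i j : ι} (hi : x ∈ M.cell i) (hj : x ∈ M.cell j) :
    ∃ p ∈ M.vertices, p ∈ M.cell i ∧ p ∈ M.cell j := by
  by_cases hij : i = j
  · subst hij
    exact ⟨_, M.vert_mem_vertices i 0, M.vert_mem_cell i 0, M.vert_mem_cell i 0⟩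
  rcases M.inter_cases hij hi hj with ⟨k, l, h, -⟩ | ⟨k, l, h, h'⟩
  · exact ⟨_, M.vert_mem_vertices i k, M.vert_mem_cell i k, h ▸ M.vert_mem_cell j l⟩
  · exact ⟨_, M.vert_mem_vertices i k, h'.ge (left_mem_segment ℝ _ _)⟩

/-- The cocycle identity is required at arbitrary points, whereas cells are compared at vertices. If
`x` is not a vertex, it lies on only one edge of cell `i`, so distinct cells through `x` share that
edge and its endpoints. -/
lemma exists_common_vertex₃ {x : Plane} {i j k : ι} (hi : x ∈ M.cell i) (hj : x ∈ M.cell j)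
    (hk : x ∈ M.cell k) : ∃ p ∈ M.vertices, p ∈ M.cell i ∧ p ∈ M.cell j ∧ p ∈ M.cell k := by
  by_cases hx : x ∈ M.vertices
  · exact ⟨x, hx, hi, hj, hk⟩
  by_cases hij : i = j
  · subst hij
    obtain ⟨p, hp, h1, h2⟩ := M.exists_common_vertex₂ hi hk
    exact ⟨p, hp, h1, h1, h2⟩
  by_cases hik : i = k
  · subst hik
    obtain ⟨p, hp, h1, h2⟩ := M.exists_common_vertex₂ hi hj
    exact ⟨p, hp, h1, h2, h1⟩
  rcases M.inter_cases hij hi hj with ⟨a, b, h, h'⟩ | ⟨a, b, h, h'⟩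
  · have : x ∈ ({M.vert i a} : Set Plane) := h' ▸ ⟨hi, hj⟩
    exact absurd (this ▸ M.vert_mem_vertices i a) hx
  have hxa : x ∈ M.edge i a := h'.le ⟨hi, hj⟩
  rcases M.inter_cases hik hi hk with ⟨c, d, g, g'⟩ | ⟨c, d, g, g'⟩
  · have : x ∈ ({M.vert i c} : Set Plane) := g' ▸ ⟨hi, hk⟩
    exact absurd (this ▸ M.vert_mem_vertices i c) hx
  have hxc : x ∈ M.edge i c := g'.le ⟨hi, hk⟩
  rcases M.edge_inter hxa hxc with rfl | ⟨m, rfl⟩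
  · exact ⟨_, M.vert_mem_vertices i a, M.vert_mem_cell i a, (h'.ge (left_mem_segment ℝ _ _)).2,
      (g'.ge (left_mem_segment ℝ _ _)).2⟩
  · exact absurd (M.vert_mem_vertices i m) hx

lemma gauss_mem_edge (i : ι) (k : Fin 4) (m : Fin 3) : M.gauss i k m ∈ M.edge i k := by
  rw [edge_eq_image]
  exact ⟨_, refGauss_mem k m, rfl⟩

lemma gauss_mem_cell (i : ι) (k : Fin 4) (m : Fin 3) : M.gauss i k m ∈ M.cell i :=
  M.edge_subset_cell i k (M.gauss_mem_edge i k m)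

lemma gauss_notMem_vertices (i : ι) (k : Fin 4) (m : Fin 3) : M.gauss i k m ∉ M.vertices := by
  intro h
  obtain ⟨j, hj⟩ := M.exists_vert_eq h (M.gauss_mem_cell i k m)
  exact refGauss_ne k m j ((M.F i).injective hj)

/-- A Gauss point lies on only one edge. -/
lemma edge_eq_of_gauss_mem {i j : ι} {k l : Fin 4} {m : Fin 3} (h : M.gauss i k m ∈ M.edge j l) :
    M.edge i k = M.edge j l := by
  have hv := M.gauss_notMem_vertices i k m
  obtain ⟨k', hk'⟩ := M.exists_edge_eq hv h (M.gauss_mem_cell i k m)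
  rcases M.edge_inter (M.gauss_mem_edge i k m) (hk' ▸ h) with rfl | ⟨n, hn⟩
  · exact hk'.symm
  · exact absurd (hn ▸ M.vert_mem_vertices i n) hv

end ParallelogramMesh

section

open Set Filter Topology unitInterval

/-! ### The domain as an injective image of the unit square -/

/-- The parametrization of the reference square by the unit square. -/
def squareParam (p : I × I) : Plane := !₂[2 * (p.1 : ℝ) - 1, 2 * (p.2 : ℝ) - 1]

lemma continuous_squareParam : Continuous squareParam := by
  refine (PiLp.continuous_toLp 2 _).comp (continuous_pi fun k => ?_)
  fin_cases k <;> simp <;> fun_prop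

lemma squareParam_injective : Function.Injective squareParam := by
  rintro ⟨a, b⟩ ⟨c, d⟩ h
  have h0 : squareParam (a, b) 0 = squareParam (c, d) 0 := by rw [h]
  have h1 : squareParam (a, b) 1 = squareParam (c, d) 1 := by rw [h]
  simp [squareParam] at h0 h1
  exact Prod.ext (Subtype.ext h0) (Subtype.ext h1)

lemma range_squareParam : range squareParam = refSquare := by
  ext x
  rw [refSquare_mem]
  constructor
  · rintro ⟨⟨⟨a, ha⟩, ⟨b, hb⟩⟩, rfl⟩
    obtain ⟨ha0, ha1⟩ := ha
    obtain ⟨hb0, hb1⟩ := hb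
    simp only [squareParam]
    refine ⟨⟨?_, ?_⟩, ?_, ?_⟩ <;> simp <;> linarith
  · rintro ⟨⟨h1, h2⟩, h3, h4⟩
    refine ⟨(⟨(x 0 + 1) / 2, by constructor <;> linarith⟩,
      ⟨(x 1 + 1) / 2, by constructor <;> linarith⟩), plane_ext ?_ ?_⟩ <;>
      simp [squareParam] <;> ring

lemma closure_openSquare : closure {x : Plane | ∀ k, x k ∈ Ioo (-1 : ℝ) 1} = refSquare := by
  have h1 : {x : Plane | ∀ k, x k ∈ Ioo (-1 : ℝ) 1} =
      (EuclideanSpace.equiv (Fin 2) ℝ).toHomeomorph ⁻¹' (univ.pi fun _ => Ioo (-1 : ℝ) 1) := by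
    ext x; simp
  rw [h1, ← Homeomorph.preimage_closure, closure_pi_set]
  ext x
  rw [mem_preimage, mem_univ_pi]
  simp [refSquare, closure_Ioo (show (-1 : ℝ) ≠ 1 by norm_num)]

lemma IsParallelogramDomain.exists_param {Ω : Set Plane} (h : IsParallelogramDomain Ω) :
    ∃ f : I × I → Plane, Continuous f ∧ Function.Injective f ∧ range f = closure Ω := by
  obtain ⟨A, rfl⟩ := h
  refine ⟨A ∘ squareParam, A.continuous_of_finiteDimensional.comp continuous_squareParam,
    A.injective.comp squareParam_injective, ?_⟩
  rw [range_comp, range_squareParam, ← closure_openSquare]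
  exact (AffineEquiv.toContinuousAffineEquiv A).toHomeomorph.image_closure _

lemma isCompact_refSquare : IsCompact refSquare := by
  rw [← range_squareParam]
  exact isCompact_range continuous_squareParam

/-! ### Topology of the cells and integration of edge data to vertex values -/

namespace ParallelogramMesh

variable {Ω : Set Plane} {ι : Type*} (M : ParallelogramMesh Ω ι)

lemma isClosed_cell (i : ι) : IsClosed (M.cell i) :=
  (isCompact_refSquare.image (M.F i).continuous_of_finiteDimensional).isClosed

lemma isPreconnected_cell (i : ι) : IsPreconnected (M.cell i) :=
  (convex_refSquare.isPreconnected).image _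
    (M.F i).continuous_of_finiteDimensional.continuousOn

lemma cell_nonempty (i : ι) : (M.cell i).Nonempty := ⟨_, M.vert_mem_cell i 0⟩

/-! ### Edge data with vanishing alternating cell sums -/

/-- `θ` assigns a number to every edge, and its alternating sum around every cell is zero. -/
structure IsEdgeData (θ : ι → Fin 4 → ℝ) : Prop where
  congr : ∀ i j k l, M.edge i k = M.edge j l → θ i k = θ j l
  alt : ∀ i, θ i 0 - θ i 1 + θ i 2 - θ i 3 = 0

/-- The values at the vertices of a cell with prescribed sums `t` over the edges, starting from the
value `c`. -/
def cellLift (t : Fin 4 → ℝ) (c : ℝ) : Fin 4 → ℝ := ![c, t 0 - c, t 1 - t 0 + c, t 3 - c]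

lemma cellLift_zero (t : Fin 4 → ℝ) (c : ℝ) : cellLift t c 0 = c := rfl

lemma cellLift_add {t : Fin 4 → ℝ} (ht : t 0 - t 1 + t 2 - t 3 = 0) (c : ℝ) (k : Fin 4) :
    cellLift t c k + cellLift t c (k + 1) = t k := by
  have h0 : cellLift t c 0 = c := rfl
  have h1 : cellLift t c 1 = t 0 - c := rfl
  have h2 : cellLift t c 2 = t 1 - t 0 + c := rfl
  have h3 : cellLift t c 3 = t 3 - c := rfl
  rcases fin_four_cases k with rfl | rfl | rfl | rfl
  · rw [zero_add, h0, h1]; ring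
  · rw [show (1 : Fin 4) + 1 = 2 from rfl, h1, h2]; ring
  · rw [show (2 : Fin 4) + 1 = 3 from rfl, h2, h3]; linarith
  · rw [show (3 : Fin 4) + 1 = 0 from rfl, h3, h0]; ring

/-- The value at each vertex is `c` or `-c` up to a constant, so the value at any one vertex can
serve as the parameter. -/
lemma cellLift_bijective (t : Fin 4 → ℝ) (k : Fin 4) :
    Function.Bijective fun c => cellLift t c k := by
  have h0 : ∀ c, cellLift t c 0 = c := fun _ => rfl
  have h1 : ∀ c, cellLift t c 1 = t 0 - c := fun _ => rfl
  have h2 : ∀ c, cellLift t c 2 = t 1 - t 0 + c := fun _ => rfl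
  have h3 : ∀ c, cellLift t c 3 = t 3 - c := fun _ => rfl
  rcases fin_four_cases k with rfl | rfl | rfl | rfl <;> simp only [h0, h1, h2, h3]
  · exact Function.bijective_id
  · exact (Equiv.subLeft (t 0)).bijective
  · exact (Equiv.addLeft (t 1 - t 0)).bijective
  · exact (Equiv.subLeft (t 3)).bijective

open Classical in
/-- The transition from the `i`-th to the `j`-th cell: the values at a common vertex agree. -/
def transition (θ : ι → Fin 4 → ℝ) (i j : ι) (c : ℝ) : ℝ :=
  if h : ∃ a b, M.vert i a = M.vert j b then
    (cellLift_bijective (θ j) h.choose_spec.choose).surjective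
      (cellLift (θ i) c h.choose) |>.choose
  -- This default plays no role: cells that meet always share a vertex.
  else c

variable {M}

/-- The transition does not depend on the chosen common vertex. Two different common vertices of
distinct cells are the ends of a common edge, on which both cells prescribe the same sum, so
agreement at one end implies agreement at the other. -/
lemma IsEdgeData.cellLift_agree {θ : ι → Fin 4 → ℝ} (hθ : M.IsEdgeData θ) {i j : ι}
    {a b a' b' : Fin 4} (h : M.vert i a = M.vert j b) (h' : M.vert i a' = M.vert j b') {c d : ℝ}
    (hcd : cellLift (θ j) d b = cellLift (θ i) c a) :
    cellLift (θ j) d b' = cellLift (θ i) c a' := by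
  by_cases haa : a = a'
  · subst haa
    obtain rfl := M.vert_injective j (h.symm.trans h')
    exact hcd
  by_cases hij : i = j
  · subst hij
    obtain rfl := M.vert_injective i h
    obtain rfl := M.vert_injective i h'
    rw [(cellLift_bijective (θ i) a).injective hcd]
  have ha : M.vert i a ∈ M.cell j := h ▸ M.vert_mem_cell j b
  have ha' : M.vert i a' ∈ M.cell j := h' ▸ M.vert_mem_cell j b'
  rcases M.inter_cases hij (M.vert_mem_cell i a) ha with ⟨k, l, -, e⟩ | ⟨k, l, g, e⟩
  · have h1 : M.vert i a ∈ ({M.vert i k} : Set Plane) := e ▸ ⟨M.vert_mem_cell i a, ha⟩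
    have h2 : M.vert i a' ∈ ({M.vert i k} : Set Plane) := e ▸ ⟨M.vert_mem_cell i a', ha'⟩
    exact absurd (M.vert_injective i (h1.trans h2.symm)) haa
  · have h1 : M.vert i a ∈ M.edge i k := e ▸ ⟨M.vert_mem_cell i a, ha⟩
    have h2 : M.vert i a' ∈ M.edge i k := e ▸ ⟨M.vert_mem_cell i a', ha'⟩
    have h3 := M.eq_of_vert_mem_edge (h ▸ g ▸ h1 : M.vert j b ∈ M.edge j l)
    have h4 := M.eq_of_vert_mem_edge (h' ▸ g ▸ h2 : M.vert j b' ∈ M.edge j l)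
    have hbb : b ≠ b' := fun hb => haa (M.vert_injective i (h.trans (hb ▸ h'.symm)))
    have s1 := cellLift_add (hθ.alt i) c k
    have s2 := cellLift_add (hθ.alt j) d l
    rw [← hθ.congr i j k l g] at s2
    rcases M.eq_of_vert_mem_edge h1 with rfl | rfl <;>
      rcases M.eq_of_vert_mem_edge h2 with rfl | rfl <;>
      rcases h3 with rfl | rfl <;> rcases h4 with rfl | rfl <;>
      first
      | exact absurd rfl haa
      | exact absurd rfl hbb
      | linarith

lemma IsEdgeData.cellLift_transition {θ : ι → Fin 4 → ℝ} (hθ : M.IsEdgeData θ) {i j : ι}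
    {a b : Fin 4} (h : M.vert i a = M.vert j b) (c : ℝ) :
    cellLift (θ j) (M.transition θ i j c) b = cellLift (θ i) c a := by
  have hex : ∃ a b, M.vert i a = M.vert j b := ⟨a, b, h⟩
  refine hθ.cellLift_agree hex.choose_spec.choose_spec h ?_
  rw [transition, dif_pos hex]
  exact Exists.choose_spec ((cellLift_bijective (θ j) hex.choose_spec.choose).surjective
      (cellLift (θ i) c hex.choose))

/-- At a vertex shared by the three cells every transition preserves the vertex value, and that
value determines the parameter of the third cell. -/
lemma IsEdgeData.isCocycle {θ : ι → Fin 4 → ℝ} (hθ : M.IsEdgeData θ) :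
    IsCocycle M.cell (M.transition θ) where
  refl i c := by simpa [cellLift_zero] using hθ.cellLift_transition (rfl : M.vert i 0 = M.vert i 0) c
  trans i j k x hi hj hk c := by
    obtain ⟨p, hp, hpi, hpj, hpk⟩ := M.exists_common_vertex₃ hi hj hk
    obtain ⟨a, rfl⟩ := M.exists_vert_eq hp hpi
    obtain ⟨b, hb⟩ := M.exists_vert_eq hp hpj
    obtain ⟨d, hd⟩ := M.exists_vert_eq hp hpk
    refine (cellLift_bijective (θ k) d).injective ?_
    rw [hθ.cellLift_transition (hb.symm.trans hd), hθ.cellLift_transition hb,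
      hθ.cellLift_transition hd]

/-- Edge data are the sums of the end values of a function on the vertices. -/
lemma IsEdgeData.exists_vertex_values [Finite ι] (hΩ : IsParallelogramDomain Ω)
    {θ : ι → Fin 4 → ℝ} (hθ : M.IsEdgeData θ) {v₀ : Plane} (hv₀ : v₀ ∈ M.vertices) (c : ℝ) :
    ∃ u : Plane → ℝ, u v₀ = c ∧ ∀ i k, u (M.vert i k) + u (M.vert i (k + 1)) = θ i k := by
  classical
  obtain ⟨f, hf, hinj, hrange⟩ := hΩ.exists_param
  obtain ⟨i₀, k₀, rfl⟩ := hv₀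
  obtain ⟨c₀, hc₀⟩ := (cellLift_bijective (θ i₀) k₀).surjective c
  obtain ⟨s, hs₀, hs⟩ := hθ.isCocycle.exists_section M.isClosed_cell M.isPreconnected_cell
    M.cell_nonempty hf hinj (M.cover.trans hrange.symm) i₀ c₀
  -- The value is read off in an arbitrary cell having `p` as a vertex; the section property makes
  -- the choice immaterial.
  let u : Plane → ℝ := fun p => if h : ∃ i k, p = M.vert i k then
    cellLift (θ h.choose) (s h.choose) h.choose_spec.choose else 0
  have hu : ∀ i k, u (M.vert i k) = cellLift (θ i) (s i) k := by
    intro i k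
    have h : ∃ j l, M.vert i k = M.vert j l := ⟨i, k, rfl⟩
    have e := h.choose_spec.choose_spec
    have : u (M.vert i k) = cellLift (θ h.choose) (s h.choose) h.choose_spec.choose := dif_pos h
    rw [this, hs i h.choose (M.vert i k) (M.vert_mem_cell i k) (mem_of_eq_of_mem e (M.vert_mem_cell _ _))]
    exact hθ.cellLift_transition e (s i)
  refine ⟨u, ?_, fun i k => ?_⟩
  · rw [← hc₀, ← hs₀]; exact hu i₀ k₀
  · rw [hu, hu, cellLift_add (hθ.alt i)]

/-- A function on the vertices that changes sign along every edge vanishes if it does at one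
vertex. -/
lemma eq_zero_of_alternating [Finite ι] (hΩ : IsParallelogramDomain Ω) {u : Plane → ℝ}
    (hu : ∀ i k, u (M.vert i k) + u (M.vert i (k + 1)) = 0) {v₀ : Plane} (hv₀ : v₀ ∈ M.vertices)
    (h₀ : u v₀ = 0) {v : Plane} (hv : v ∈ M.vertices) : u v = 0 := by
  have hcell : ∀ i k, u (M.vert i k) = 0 → ∀ l, u (M.vert i l) = 0 := by
    intro i k h
    have a0 := hu i 0
    have a1 := hu i 1
    have a2 := hu i 2
    have a3 := hu i 3
    simp only [zero_add, show (1 : Fin 4) + 1 = 2 from rfl, show (2 : Fin 4) + 1 = 3 from rfl,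
      show (3 : Fin 4) + 1 = 0 from rfl] at a0 a1 a2 a3
    intro l
    rcases fin_four_cases k with rfl | rfl | rfl | rfl <;>
      rcases fin_four_cases l with rfl | rfl | rfl | rfl <;> linarith
  obtain ⟨f, hf, -, hrange⟩ := hΩ.exists_param
  have hcov : ⋃ i, M.cell i = closure Ω := M.cover
  have hpre : IsPreconnected (closure Ω) := hrange ▸ isPreconnected_range hf
  -- `P x` says that `u` vanishes on all cells through `x`. One vanishing vertex value in one such
  -- cell suffices, since cells through `x` share a vertex; so `P` is locally constant on the
  -- connected closed domain.
  let P : Plane → Prop := fun x => ∀ i k, x ∈ M.cell i → u (M.vert i k) = 0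
  have hP : ∀ x i k, x ∈ M.cell i → u (M.vert i k) = 0 → P x := by
    intro x i k hi h j l hj
    obtain ⟨p, hp, hpi, hpj⟩ := M.exists_common_vertex₂ hi hj
    obtain ⟨a, rfl⟩ := M.exists_vert_eq hp hpi
    obtain ⟨b, hb⟩ := M.exists_vert_eq hp hpj
    exact hcell j b (hb ▸ hcell i k h a) l
  obtain ⟨i₀, k₀, rfl⟩ := hv₀
  obtain ⟨i, k, rfl⟩ := hv
  have hsub : ∀ i, M.cell i ⊆ closure Ω := fun i => hcov ▸ subset_iUnion M.cell i
  have key : P (M.vert i₀ k₀) ↔ P (M.vert i k) := by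
    refine hpre.induction₂ (fun a b => P a ↔ P b) (fun a ha => ?_)
      (fun _ _ _ _ _ _ h h' => h.trans h') (fun _ _ _ _ h => h.symm)
      (hsub i₀ (M.vert_mem_cell i₀ k₀)) (hsub i (M.vert_mem_cell i k))
    filter_upwards [nhdsWithin_le_nhds (eventually_mem_cover_imp M.isClosed_cell a),
      self_mem_nhdsWithin] with b h3 hb
    obtain ⟨j, hj⟩ := mem_iUnion.1 (hcov.ge hb)
    exact ⟨fun h => hP b j 0 hj (h j 0 (h3 j hj)), fun h => hP a j 0 (h3 j hj) (h j 0 hj)⟩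
  exact key.1 (hP _ i₀ k₀ (M.vert_mem_cell i₀ k₀) h₀) i k (M.vert_mem_cell i k)

end ParallelogramMesh

end

/-! ### Gauss points of segments -/

/-- The `m`-th Gauss point on the way from `a` to `b`. -/
def gaussPt (a b : Plane) (m : Fin 3) : Plane := AffineMap.lineMap a b (gaussNode m)

lemma gaussNode_rev (m : Fin 3) : gaussNode (2 - m) = 1 - gaussNode m := by
  rcases fin_three_cases m with rfl | rfl | rfl
  · rw [show (2 : Fin 3) - 0 = 2 from rfl, gaussNode_zero, gaussNode_two]; ring
  · rw [show (2 : Fin 3) - 1 = 1 from rfl, gaussNode_one]; ring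
  · rw [show (2 : Fin 3) - 2 = 0 from rfl, gaussNode_zero, gaussNode_two]; ring

lemma gaussPt_swap (a b : Plane) (m : Fin 3) : gaussPt b a m = gaussPt a b (2 - m) := by
  rw [gaussPt, gaussPt, gaussNode_rev, AffineMap.lineMap_apply_one_sub]

lemma gaussPt_mem (a b : Plane) (m : Fin 3) : gaussPt a b m ∈ segment ℝ a b :=
  mem_segment_lineMap.2 ⟨_, ⟨(gaussNode_mem m).1.le, (gaussNode_mem m).2.le⟩, rfl⟩

lemma gaussPt_injective {a b : Plane} (hab : a ≠ b) : Function.Injective (gaussPt a b) :=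
  (AffineMap.lineMap_injective ℝ hab).comp gaussNode_injective

lemma midPts_segment (a b : Plane) : midPts (segment ℝ a b) = {gaussPt a b 1} := by
  have hm : ∀ a b : Plane, midpoint ℝ a b = gaussPt a b 1 := fun a b => by
    rw [gaussPt, gaussNode_one, midpoint, one_div, invOf_eq_inv]
  ext g
  constructor
  · rintro ⟨c, d, h, rfl⟩
    rw [hm]
    rcases segment_eq_segment h with ⟨rfl, rfl⟩ | ⟨rfl, rfl⟩
    · rfl
    · exact gaussPt_swap _ _ 1
  · rintro rfl
    exact ⟨a, b, rfl, (hm a b).symm⟩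

lemma sideGauss_segment (a b : Plane) :
    sideGauss (segment ℝ a b) = {gaussPt a b 0, gaussPt a b 2} := by
  ext g
  constructor
  · rintro ⟨c, d, h, rfl⟩
    rcases segment_eq_segment h with ⟨rfl, rfl⟩ | ⟨rfl, rfl⟩
    · exact Or.inr rfl
    · exact Or.inl (gaussPt_swap a b 2)
  · rintro (rfl | rfl)
    · exact ⟨b, a, segment_symm ℝ a b, (gaussPt_swap a b 2).symm⟩
    · exact ⟨a, b, rfl, rfl⟩

lemma mem_gaussOn_segment {a b g : Plane} :
    g ∈ gaussOn (segment ℝ a b) ↔ ∃ m, g = gaussPt a b m := by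
  rw [gaussOn, midPts_segment, sideGauss_segment]
  constructor
  · rintro (h | h | h)
    exacts [⟨_, h⟩, ⟨_, h⟩, ⟨_, h⟩]
  · rintro ⟨m, rfl⟩
    rcases fin_three_cases m with rfl | rfl | rfl
    exacts [Or.inr (Or.inl rfl), Or.inl rfl, Or.inr (Or.inr rfl)]

lemma edgeFunctional_swap (w : Plane → ℝ) (a b : Plane) :
    edgeFunctional (fun m => w (gaussPt b a m)) = edgeFunctional fun m => w (gaussPt a b m) := by
  simp only [edgeFunctional, gaussPt_swap a b]
  rw [show (2 : Fin 3) - 0 = 2 from rfl, show (2 : Fin 3) - 1 = 1 from rfl,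
    show (2 : Fin 3) - 2 = 0 from rfl]
  ring

/-- The weights `5, -4, 5` are symmetric, so the functional depends on the edge as a set only. This
is what makes the edge data well defined across cells. -/
lemma edgeFunctional_congr (w : Plane → ℝ) {a b c d : Plane} (h : segment ℝ a b = segment ℝ c d) :
    edgeFunctional (fun m => w (gaussPt a b m)) = edgeFunctional fun m => w (gaussPt c d m) := by
  rcases segment_eq_segment h with ⟨rfl, rfl⟩ | ⟨rfl, rfl⟩
  · rfl
  · exact edgeFunctional_swap w _ _

namespace ParallelogramMesh

variable {Ω : Set Plane} {ι : Type*} (M : ParallelogramMesh Ω ι)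

lemma gauss_eq_gaussPt (i : ι) (k : Fin 4) (m : Fin 3) :
    M.gauss i k m = gaussPt (M.vert i k) (M.vert i (k + 1)) m := M.gauss_eq i k m

variable {M}

lemma exists_of_segment_mem_edges {a b : Plane} (h : segment ℝ a b ∈ M.edges) :
    ∃ i k, (a = M.vert i k ∧ b = M.vert i (k + 1)) ∨ (a = M.vert i (k + 1) ∧ b = M.vert i k) := by
  obtain ⟨i, k, h⟩ := h
  exact ⟨i, k, segment_eq_segment h⟩

lemma ne_of_segment_mem_edges {a b : Plane} (h : segment ℝ a b ∈ M.edges) : a ≠ b := by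
  obtain ⟨i, k, ⟨rfl, rfl⟩ | ⟨rfl, rfl⟩⟩ := exists_of_segment_mem_edges h
  exacts [M.vert_ne_succ i k, (M.vert_ne_succ i k).symm]

lemma gaussPt_mem_gaussPoints {a b : Plane} (h : segment ℝ a b ∈ M.edges) (m : Fin 3) :
    gaussPt a b m ∈ M.gaussPoints :=
  Set.mem_biUnion h (mem_gaussOn_segment.2 ⟨m, rfl⟩)

lemma eq_of_gaussPt_mem {a b : Plane} (h : segment ℝ a b ∈ M.edges) {m : Fin 3} {E : Set Plane}
    (hE : E ∈ M.edges) (hm : gaussPt a b m ∈ E) : E = segment ℝ a b := by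
  obtain ⟨j, l, rfl⟩ := hE
  obtain ⟨i, k, ⟨rfl, rfl⟩ | ⟨rfl, rfl⟩⟩ := exists_of_segment_mem_edges h
  · rw [← gauss_eq_gaussPt] at hm
    exact (M.edge_eq_of_gauss_mem hm).symm
  · rw [gaussPt_swap, ← gauss_eq_gaussPt] at hm
    rw [segment_symm ℝ (M.vert i (k + 1))]
    exact (M.edge_eq_of_gauss_mem hm).symm

/-- Distances from `a` are `gaussNode n` times the length of the edge, smallest for `n = 0`. No
other edge interferes because a Gauss point lies on a single edge. -/
lemma gaussPt_mem_gaussNear {a b : Plane} (h : segment ℝ a b ∈ M.edges) {m : Fin 3} {v : Plane} :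
    gaussPt a b m ∈ M.gaussNear v ↔ (v = a ∧ m = 0) ∨ (v = b ∧ m = 2) := by
  have hd : ∀ {a b : Plane}, segment ℝ a b ∈ M.edges → ∀ {m : Fin 3},
      (∀ n, dist a (gaussPt a b m) ≤ dist a (gaussPt a b n)) ↔ m = 0 := by
    intro a b h m
    have hab : 0 < dist a b := dist_pos.2 (ne_of_segment_mem_edges h)
    have hdist : ∀ n, dist a (gaussPt a b n) = gaussNode n * dist a b := fun n => by
      rw [gaussPt, dist_left_lineMap, Real.norm_of_nonneg (gaussNode_mem n).1.le]
    simp only [hdist, mul_le_mul_iff_left₀ hab]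
    have := sqrt_pos
    constructor
    · intro h
      have h0 := h 0
      rcases fin_three_cases m with rfl | rfl | rfl
      · rfl
      · rw [gaussNode_zero, gaussNode_one] at h0
        linarith
      · rw [gaussNode_zero, gaussNode_two] at h0
        linarith
    · rintro rfl n
      rcases fin_three_cases n with rfl | rfl | rfl
      · exact le_rfl
      · rw [gaussNode_zero, gaussNode_one]
        linarith
      · rw [gaussNode_zero, gaussNode_two]
        linarith
  have hrev : ∀ n : Fin 3, 2 - n = 0 ↔ n = 2 := by decide
  have hrev' : ∀ n : Fin 3, 2 - (2 - n) = n := by decide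
  constructor
  · rintro ⟨E, hE, hv, hg, hmin⟩
    have hmem : gaussPt a b m ∈ E := by
      obtain ⟨j, l, rfl⟩ := hE
      obtain ⟨n, hn⟩ := mem_gaussOn_segment.1 hg
      exact hn ▸ gaussPt_mem _ _ _
    obtain rfl := eq_of_gaussPt_mem h hE hmem
    have hmin' : ∀ n, dist v (gaussPt a b m) ≤ dist v (gaussPt a b n) := fun n =>
      hmin _ (mem_gaussOn_segment.2 ⟨n, rfl⟩)
    obtain ⟨c, hc⟩ := hv
    rcases segment_eq_segment hc with ⟨rfl, rfl⟩ | ⟨rfl, rfl⟩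
    · exact Or.inl ⟨rfl, (hd h).1 hmin'⟩
    · refine Or.inr ⟨rfl, (hrev m).1 ((hd (segment_symm ℝ a b ▸ h)).1 fun n => ?_)⟩
      rw [gaussPt_swap, gaussPt_swap a, hrev']
      exact hmin' _
  · have key : ∀ {a b : Plane}, segment ℝ a b ∈ M.edges → gaussPt a b 0 ∈ M.gaussNear a := by
      intro a b h
      refine ⟨_, h, ⟨b, rfl⟩, mem_gaussOn_segment.2 ⟨0, rfl⟩, fun g' hg' => ?_⟩
      obtain ⟨n, rfl⟩ := mem_gaussOn_segment.1 hg'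
      exact (hd h).2 rfl n
    rintro (⟨rfl, rfl⟩ | ⟨rfl, rfl⟩)
    · exact key h
    · have := key (segment_symm ℝ a v ▸ h)
      rwa [gaussPt_swap] at this

/-! ### Gauss values determine and define nonconforming functions -/

lemma mem_cellSpace {i : ι} {ψ : M.cell i → ℝ} :
    ψ ∈ M.cellSpace i ↔ ∃ c, ∀ x, ψ x = shape c ((M.F i).symm x.1) := by
  constructor
  · rintro ⟨f, hf, rfl⟩
    obtain ⟨c, hc⟩ := mem_refSpace.1 hf
    exact ⟨c, fun x => hc (M.toRef i x)⟩
  · rintro ⟨c, hc⟩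
    exact ⟨fun y => shape c y.1, mem_refSpace.2 ⟨c, fun _ => rfl⟩, funext fun x => (hc x).symm⟩

lemma gauss_mem_gaussPoints (i : ι) (k : Fin 4) (m : Fin 3) : M.gauss i k m ∈ M.gaussPoints := by
  rw [gauss_eq_gaussPt]
  exact gaussPt_mem_gaussPoints (M.edge_mem_edges i k) m

lemma exists_gauss_eq {g : Plane} (hg : g ∈ M.gaussPoints) {i : ι} (hi : g ∈ M.cell i) :
    ∃ k m, g = M.gauss i k m := by
  obtain ⟨E, hE, hgE⟩ := Set.mem_iUnion₂.1 hg
  obtain ⟨j, l, rfl⟩ := hE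
  obtain ⟨m, rfl⟩ := mem_gaussOn_segment.1 hgE
  have e : gaussPt (M.F j (refVertex l)) (M.F j (refVertex (l + 1))) m = M.gauss j l m :=
    (M.gauss_eq_gaussPt j l m).symm
  rw [e] at hi ⊢
  obtain ⟨k, hk⟩ := M.exists_edge_eq (M.gauss_notMem_vertices j l m) (M.gauss_mem_edge j l m) hi
  have : M.gauss j l m ∈ gaussOn (M.edge i k) := by
    rw [← hk, gauss_eq_gaussPt]
    exact mem_gaussOn_segment.2 ⟨m, rfl⟩
  obtain ⟨n, hn⟩ := mem_gaussOn_segment.1 this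
  exact ⟨k, n, hn.trans (M.gauss_eq_gaussPt i k n).symm⟩

lemma hasGaussValues_iff {φ : M.NC} {w : Plane → ℝ} : M.HasGaussValues φ w ↔
    ∀ i k m, φ.1 i ⟨M.gauss i k m, M.gauss_mem_cell i k m⟩ = w (M.gauss i k m) := by
  constructor
  · exact fun h i k m => h _ (gauss_mem_gaussPoints i k m) i _
  · intro h g hg i hi
    obtain ⟨k, m, rfl⟩ := exists_gauss_eq hg hi
    exact h i k m

lemma exists_hasGaussValues (φ : M.NC) : ∃ w, M.HasGaussValues φ w := by
  classical
  -- Any cell containing `g` may be used, by continuity at the Gauss points.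
  refine ⟨fun g => if h : ∃ i, g ∈ M.cell i then φ.1 h.choose ⟨g, h.choose_spec⟩ else 0, ?_⟩
  intro g hg i hi
  have h : ∃ i, g ∈ M.cell i := ⟨i, hi⟩
  beta_reduce
  rw [dif_pos h]
  exact φ.2.2 g hg _ _ _ _

lemma HasGaussValues.ext {φ ψ : M.NC}
    (h : ∀ i k m, φ.1 i ⟨M.gauss i k m, M.gauss_mem_cell i k m⟩ =
      ψ.1 i ⟨M.gauss i k m, M.gauss_mem_cell i k m⟩) : φ = ψ := by
  refine Subtype.ext (funext fun i => ?_)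
  obtain ⟨c, hc⟩ := mem_cellSpace.1 (sub_mem (φ.2.1 i) (ψ.2.1 i))
  have hc0 : c = 0 := shape_eq_zero fun k m => by
    have := hc ⟨M.gauss i k m, M.gauss_mem_cell i k m⟩
    rw [Pi.sub_apply, h i k m, sub_self] at this
    simpa [gauss] using this.symm
  funext x
  have := hc x
  rw [hc0] at this
  simpa [shape, sub_eq_zero] using this

lemma HasGaussValues.unique {φ ψ : M.NC} {w : Plane → ℝ} (hφ : M.HasGaussValues φ w)
    (hψ : M.HasGaussValues ψ w) : φ = ψ :=
  HasGaussValues.ext fun i k m => by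
    rw [hasGaussValues_iff.1 hφ, hasGaussValues_iff.1 hψ]

lemma HasGaussValues.cellFunctional_eq_zero {φ : M.NC} {w : Plane → ℝ} (h : M.HasGaussValues φ w)
    (i : ι) : cellFunctional (fun k m => w (M.gauss i k m)) = 0 := by
  obtain ⟨c, hc⟩ := mem_cellSpace.1 (φ.2.1 i)
  rw [← cellFunctional_shape c]
  congr
  ext k m
  rw [← hasGaussValues_iff.1 h, hc]
  simp [gauss]

/-- The functions are found cell by cell. Continuity at the Gauss points is automatic, because all
cells interpolate the same `w`. -/
lemma exists_of_cellFunctional_eq_zero {w : Plane → ℝ}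
    (h : ∀ i, cellFunctional (fun k m => w (M.gauss i k m)) = 0) :
    ∃ φ : M.NC, M.HasGaussValues φ w := by
  choose c hc using fun i => exists_shape_of_cellFunctional_eq_zero (h i)
  have hval : ∀ i k m, shape (c i) ((M.F i).symm (M.gauss i k m)) = w (M.gauss i k m) := by
    intro i k m
    rw [← hc i k m, gauss, AffineEquiv.symm_apply_apply]
  refine ⟨⟨fun i x => shape (c i) ((M.F i).symm x.1),
    fun i => mem_cellSpace.2 ⟨c i, fun _ => rfl⟩, fun g hg i j hi hj => ?_⟩,
    hasGaussValues_iff.2 hval⟩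
  obtain ⟨k, m, hkm⟩ := exists_gauss_eq hg hi
  obtain ⟨l, n, hln⟩ := exists_gauss_eq hg hj
  change shape (c i) ((M.F i).symm g) = shape (c j) ((M.F j).symm g)
  have h1 := hval i k m
  have h2 := hval j l n
  rw [← hkm] at h1
  rw [← hln] at h2
  rw [h1, h2]

/-! ### The prescribed Gauss values -/

lemma vertexValues_gaussPt {a b : Plane} (h : segment ℝ a b ∈ M.edges) (v : Plane) (m : Fin 3) :
    M.vertexValues v (gaussPt a b m) =
      open Classical in if (v = a ∧ m = 0) ∨ (v = b ∧ m = 2) then 1 else 0 := by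
  rw [vertexValues]
  simp only [gaussPt_mem_gaussNear h]

/-- The order `i < k` removes the ambiguity of the unordered pair of side Gauss points. -/
lemma isPlus_isMinus_iff {γ : Fin M.numGauss ≃ M.gaussPoints} {E : Set Plane}
    {i k : Fin M.numGauss} (hik : i < k) (hE : sideGauss E = {(γ i).1, (γ k).1}) (g : Plane) :
    (M.IsPlus γ E g ↔ g = γ i) ∧ (M.IsMinus γ E g ↔ g = γ k) := by
  have key : ∀ j l, j < l → sideGauss E = {(γ j).1, (γ l).1} → j = i ∧ l = k := by
    intro j l hjl h
    rw [hE, Set.pair_eq_pair_iff] at h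
    simp only [Subtype.val_inj, γ.injective.eq_iff] at h
    omega
  refine ⟨⟨?_, fun h => ⟨i, k, hik, hE, h⟩⟩, ⟨?_, fun h => ⟨i, k, hik, hE, h⟩⟩⟩
  · rintro ⟨j, l, hjl, h, rfl⟩
    rw [(key j l hjl h).1]
  · rintro ⟨j, l, hjl, h, rfl⟩
    rw [(key j l hjl h).2]

/-- An edge can be oriented such that the Gauss point with the smaller number comes first. -/
lemma exists_orientation (γ : Fin M.numGauss ≃ M.gaussPoints) {E : Set Plane} (hE : E ∈ M.edges) :
    ∃ a b i, E = segment ℝ a b ∧ a ∈ M.vertices ∧ b ∈ M.vertices ∧ E ⊆ M.cell i ∧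
      ∀ g, (M.IsPlus γ E g ↔ g = gaussPt a b 0) ∧ (M.IsMinus γ E g ↔ g = gaussPt a b 2) := by
  obtain ⟨i, k, rfl⟩ := hE
  change ∃ a b j, M.edge i k = _ ∧ _ ∧ _ ∧ _ ∧ ∀ g, (M.IsPlus γ (M.edge i k) g ↔ _) ∧
    (M.IsMinus γ (M.edge i k) g ↔ _)
  have hE := M.edge_mem_edges i k
  obtain ⟨p, hp⟩ := γ.surjective ⟨_, gaussPt_mem_gaussPoints hE 0⟩
  obtain ⟨q, hq⟩ := γ.surjective ⟨_, gaussPt_mem_gaussPoints hE 2⟩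
  have hp' : (γ p).1 = gaussPt (M.vert i k) (M.vert i (k + 1)) 0 := by rw [hp]
  have hq' : (γ q).1 = gaussPt (M.vert i k) (M.vert i (k + 1)) 2 := by rw [hq]
  have hs : sideGauss (M.edge i k) = {(γ p).1, (γ q).1} := by
    rw [hp', hq', edge, sideGauss_segment]
  have hpq : p ≠ q := by
    rintro rfl
    have := gaussPt_injective (ne_of_segment_mem_edges hE) (hp'.symm.trans hq')
    exact absurd this (by decide)
  rcases lt_or_gt_of_ne hpq with hlt | hlt
  · refine ⟨M.vert i k, M.vert i (k + 1), i, rfl, M.vert_mem_vertices _ _, M.vert_mem_vertices _ _,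
      M.edge_subset_cell i k, fun g => ?_⟩
    rw [← hp', ← hq']
    exact isPlus_isMinus_iff hlt hs g
  · refine ⟨M.vert i (k + 1), M.vert i k, i, segment_symm _ _ _, M.vert_mem_vertices _ _,
      M.vert_mem_vertices _ _, M.edge_subset_cell i k, fun g => ?_⟩
    rw [gaussPt_swap, gaussPt_swap _ _ 2, show (2 : Fin 3) - 0 = 2 from rfl,
      show (2 : Fin 3) - 2 = 0 from rfl, ← hp', ← hq']
    rw [Set.pair_comm] at hs
    exact isPlus_isMinus_iff hlt hs g

/-- The values `5` at the midpoint of the segment `E`, `4` at `q` and `0` elsewhere. -/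
def edgeValues (E : Set Plane) (q : Plane) (g : Plane) : ℝ :=
  open Classical in if g ∈ midPts E then 5 else if g = q then 4 else 0

lemma edgeValues_gaussPt {a b : Plane} (h : segment ℝ a b ∈ M.edges) {c d : Plane}
    (h' : segment ℝ c d ∈ M.edges) (n m : Fin 3) :
    edgeValues (segment ℝ a b) (gaussPt a b n) (gaussPt c d m) =
      open Classical in if segment ℝ a b = segment ℝ c d then
        edgeValues (segment ℝ c d) (gaussPt a b n) (gaussPt c d m) else 0 := by
  classical
  split_ifs with e
  · rw [e]
  · rw [edgeValues, if_neg, if_neg]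
    · intro hm
      exact e (eq_of_gaussPt_mem h' h (hm ▸ gaussPt_mem a b n))
    · rw [midPts_segment]
      intro hm
      exact e (eq_of_gaussPt_mem h' h ((Set.mem_singleton_iff.1 hm).symm ▸ gaussPt_mem a b 1))

lemma edgeValues_self {a b : Plane} (h : segment ℝ a b ∈ M.edges) (n m : Fin 3) :
    edgeValues (segment ℝ a b) (gaussPt a b n) (gaussPt a b m) =
      if m = 1 then 5 else if m = n then 4 else 0 := by
  classical
  have := gaussPt_injective (ne_of_segment_mem_edges h)
  rw [edgeValues, midPts_segment]
  simp only [Set.mem_singleton_iff, this.eq_iff]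

/-- On the edge itself the value is `5 * 4 - 4 * 5 = 0`, which explains the values 5 and 4. All
Gauss values on other edges vanish. -/
lemma edgeFunctional_edgeValues {a b : Plane} (h : segment ℝ a b ∈ M.edges) {n : Fin 3}
    (hn : n ≠ 1) {c d : Plane} (h' : segment ℝ c d ∈ M.edges) :
    edgeFunctional (fun m => edgeValues (segment ℝ a b) (gaussPt a b n) (gaussPt c d m)) = 0 := by
  by_cases e : segment ℝ a b = segment ℝ c d
  · rw [← edgeFunctional_congr _ e]
    simp only [edgeValues_self h, edgeFunctional]
    have h02 : (0 : Fin 3) ≠ 2 := by decide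
    have h12 : (1 : Fin 3) ≠ 2 := by decide
    rcases fin_three_cases n with rfl | rfl | rfl
    · norm_num [h02.symm, h12.symm]
    · exact absurd rfl hn
    · norm_num [h02, h12.symm]
  · simp only [edgeValues_gaussPt h h', if_neg e]
    simp [edgeFunctional]

lemma exists_hasGaussValues_edgeValues {a b : Plane} (h : segment ℝ a b ∈ M.edges) {n : Fin 3}
    (hn : n ≠ 1) : ∃ φ : M.NC, M.HasGaussValues φ (edgeValues (segment ℝ a b) (gaussPt a b n)) := by
  refine exists_of_cellFunctional_eq_zero fun i => ?_
  simp only [gauss_eq_gaussPt, cellFunctional]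
  simp only [edgeFunctional_edgeValues h hn (M.edge_mem_edges i _)]
  ring

lemma exists_hasGaussValues_vertexValues (v : Plane) :
    ∃ φ : M.NC, M.HasGaussValues φ (M.vertexValues v) := by
  classical
  refine exists_of_cellFunctional_eq_zero fun i => ?_
  -- A vertex of the cell is an endpoint of two consecutive edges, which enter the cell functional
  -- with opposite signs.
  have key : ∀ k, edgeFunctional (fun m => M.vertexValues v (M.gauss i k m)) =
      5 * (if v = M.vert i k then 1 else 0) + 5 * (if v = M.vert i (k + 1) then 1 else 0) := by
    intro k
    simp only [gauss_eq_gaussPt, edgeFunctional]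
    rw [vertexValues_gaussPt (M.edge_mem_edges i k), vertexValues_gaussPt (M.edge_mem_edges i k),
      vertexValues_gaussPt (M.edge_mem_edges i k)]
    simp
  rw [cellFunctional, key, key, key, key, zero_add, show (1 : Fin 4) + 1 = 2 from rfl,
    show (2 : Fin 4) + 1 = 3 from rfl, show (3 : Fin 4) + 1 = 0 from rfl]
  ring

/-- The edge functionals of Gauss values of a nonconforming function are sums of vertex values. -/
lemma HasGaussValues.exists_vertex_values [Finite ι] (hΩ : IsParallelogramDomain Ω) {φ : M.NC}
    {w : Plane → ℝ} (h : M.HasGaussValues φ w) {v₀ : Plane} (hv₀ : v₀ ∈ M.vertices) :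
    ∃ u : Plane → ℝ, ∀ a b, segment ℝ a b ∈ M.edges →
      u a + u b = edgeFunctional fun m => w (gaussPt a b m) := by
  have hθ : M.IsEdgeData fun i k => edgeFunctional fun m => w (M.gauss i k m) := by
    refine ⟨fun i j k l e => ?_, h.cellFunctional_eq_zero⟩
    simp only [gauss_eq_gaussPt]
    exact edgeFunctional_congr w e
  obtain ⟨u, -, hu⟩ := hθ.exists_vertex_values hΩ hv₀ 0
  refine ⟨u, fun a b hab => ?_⟩
  obtain ⟨i, k, ⟨rfl, rfl⟩ | ⟨rfl, rfl⟩⟩ := exists_of_segment_mem_edges hab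
  · rw [hu]
    simp only [gauss_eq_gaussPt]
  · rw [add_comm, hu, edgeFunctional_swap]
    simp only [gauss_eq_gaussPt]

/-- Zero edge data integrated from the value 1: the edge graph is bipartite. -/
lemma exists_alternating [Finite ι] (hΩ : IsParallelogramDomain Ω) {v₀ : Plane}
    (hv₀ : v₀ ∈ M.vertices) :
    ∃ u : Plane → ℝ, u v₀ = 1 ∧ ∀ a b, segment ℝ a b ∈ M.edges → u a + u b = 0 := by
  have hθ : M.IsEdgeData fun _ _ => 0 := ⟨fun _ _ _ _ _ => rfl, fun _ => by norm_num⟩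
  obtain ⟨u, hu₀, hu⟩ := hθ.exists_vertex_values hΩ hv₀ 1
  refine ⟨u, hu₀, fun a b hab => ?_⟩
  obtain ⟨i, k, ⟨rfl, rfl⟩ | ⟨rfl, rfl⟩⟩ := exists_of_segment_mem_edges hab
  · exact hu i k
  · rw [add_comm, hu]

end ParallelogramMesh

/-! ### The linear algebra of vertex and edge functions -/

section Graph

variable {V D W : Type*} [AddCommGroup W] [Module ℝ W]

/-- A space of functions with three values on every oriented edge `a e → b e` of a graph, together
with functions that belong to the vertices and edges. -/
structure GraphSystem (a b : D → V) (ev : W →ₗ[ℝ] (D → Fin 3 → ℝ)) (fV : V → W) (fP fM : D → W) :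
    Prop where
  inj : Function.Injective ev
  ev_vertex : ∀ v e m, ev (fV v) e m =
    open Classical in if (v = a e ∧ m = 0) ∨ (v = b e ∧ m = 2) then 1 else 0
  ev_plus : ∀ e' e m, ev (fP e') e m =
    open Classical in if e' = e then (if m = 1 then 5 else if m = 0 then 4 else 0) else 0
  ev_minus : ∀ e' e m, ev (fM e') e m =
    open Classical in if e' = e then (if m = 1 then 5 else if m = 2 then 4 else 0) else 0
  -- The last three conditions express that edge functionals come from vertex values and that the
  -- alternating functions form a line of nowhere vanishing functions.
  exact : ∀ φ, ∃ u : V → ℝ, ∀ e, u (a e) + u (b e) = edgeFunctional (ev φ e)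
  exists_alternating : ∀ v₀, ∃ u : V → ℝ, u v₀ = 1 ∧ ∀ e, u (a e) + u (b e) = 0
  eq_zero : ∀ u : V → ℝ, (∀ e, u (a e) + u (b e) = 0) → ∀ v₀, u v₀ = 0 → u = 0

namespace GraphSystem

variable {a b : D → V} {ev : W →ₗ[ℝ] (D → Fin 3 → ℝ)} {fV : V → W} {fP fM : D → W}
  [Fintype V] [Fintype D]

/-- The combination of all functions with given coefficients. -/
def comb (fV : V → W) (fP fM : D → W) (c : V ⊕ D ⊕ D → ℝ) : W :=
  ∑ s, c s • Sum.elim fV (Sum.elim fP fM) s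

lemma ev_comb (h : GraphSystem a b ev fV fP fM) (c : V ⊕ D ⊕ D → ℝ) (e : D) :
    ev (comb fV fP fM c) e 0 = c (.inl (a e)) + 4 * c (.inr (.inl e)) ∧
    ev (comb fV fP fM c) e 1 = 5 * (c (.inr (.inl e)) + c (.inr (.inr e))) ∧
    ev (comb fV fP fM c) e 2 = c (.inl (b e)) + 4 * c (.inr (.inr e)) := by
  classical
  have key : ∀ m, ev (comb fV fP fM c) e m = ∑ v, c (.inl v) * ev (fV v) e m +
      (∑ d, c (.inr (.inl d)) * ev (fP d) e m + ∑ d, c (.inr (.inr d)) * ev (fM d) e m) := by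
    intro m
    simp [comb, Fintype.sum_sum_type, Finset.sum_apply]
  have h02 : (0 : Fin 3) ≠ 2 := by decide
  have h12 : (1 : Fin 3) ≠ 2 := by decide
  refine ⟨?_, ?_, ?_⟩ <;> rw [key] <;>
    simp [h.ev_vertex, h.ev_plus, h.ev_minus, h02, h12, h02.symm, h12.symm] <;> ring

/-- The midpoint values give opposite coefficients for the two functions of an edge, so the side
values make the vertex coefficients alternating. These are -4 times the edge coefficients, hence one
zero anywhere yields a vertex with coefficient zero. -/
lemma kernel (h : GraphSystem a b ev fV fP fM) {c : V ⊕ D ⊕ D → ℝ} (hc : comb fV fP fM c = 0)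
    {s₀ : V ⊕ D ⊕ D} (hs₀ : c s₀ = 0) : c = 0 := by
  have e0 : ∀ e, c (.inl (a e)) + 4 * c (.inr (.inl e)) = 0 := fun e => by
    rw [← (h.ev_comb c e).1, hc]; simp
  have e1 : ∀ e, c (.inr (.inl e)) + c (.inr (.inr e)) = 0 := fun e => by
    have := (h.ev_comb c e).2.1
    rw [hc] at this
    simpa using this.symm
  have e2 : ∀ e, c (.inl (b e)) + 4 * c (.inr (.inr e)) = 0 := fun e => by
    rw [← (h.ev_comb c e).2.2, hc]; simp
  obtain ⟨v₀, hv₀⟩ : ∃ v, c (.inl v) = 0 := by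
    rcases s₀ with v | e | e
    · exact ⟨v, hs₀⟩
    · exact ⟨a e, by linarith [e0 e]⟩
    · exact ⟨b e, by linarith [e2 e]⟩
  have hV := h.eq_zero (fun v => c (.inl v)) (fun e => by linarith [e0 e, e1 e, e2 e]) v₀ hv₀
  have hV' : ∀ v, c (.inl v) = 0 := fun v => congrFun hV v
  ext s
  rcases s with v | e | e
  · exact hV' v
  · have := e0 e
    rw [hV'] at this
    simpa using this
  · have := e2 e
    rw [hV'] at this
    simpa using this

lemma exists_comb_eq (h : GraphSystem a b ev fV fP fM) (φ : W) :
    ∃ c, comb fV fP fM c = φ := by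
  obtain ⟨u, hu⟩ := h.exact φ
  -- Vertex functions have edge functional 5, hence `u v / 5`. The edge coefficients are then solved
  -- from the two side values, and the midpoint value matches by the equation for `u`.
  refine ⟨Sum.elim (fun v => u v / 5) (Sum.elim (fun e => (ev φ e 0 - u (a e) / 5) / 4)
    fun e => (ev φ e 2 - u (b e) / 5) / 4), h.inj ?_⟩
  ext e m
  obtain ⟨h0, h1, h2⟩ := h.ev_comb (Sum.elim (fun v => u v / 5)
    (Sum.elim (fun e => (ev φ e 0 - u (a e) / 5) / 4) fun e => (ev φ e 2 - u (b e) / 5) / 4)) e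
  have := hu e
  rw [edgeFunctional] at this
  rcases fin_three_cases m with rfl | rfl | rfl
  · rw [h0]
    simp only [Sum.elim_inl, Sum.elim_inr]
    ring
  · rw [h1]
    simp only [Sum.elim_inl, Sum.elim_inr]
    linarith
  · rw [h2]
    simp only [Sum.elim_inl, Sum.elim_inr]
    ring

/-- An alternating function on the vertices extends to a relation with edge coefficients `-u/4` at
the respective ends. Normalizing it at a suitable vertex makes any prescribed coefficient nonzero.
-/
lemma exists_kernel (h : GraphSystem a b ev fV fP fM) (s₀ : V ⊕ D ⊕ D) :
    ∃ c, comb fV fP fM c = 0 ∧ c s₀ ≠ 0 := by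
  have key : ∀ v₀, ∃ c : V ⊕ D ⊕ D → ℝ, comb fV fP fM c = 0 ∧ c (.inl v₀) = 1 ∧
      (∀ e, c (.inr (.inl e)) = - c (.inl (a e)) / 4) ∧
      ∀ e, c (.inr (.inr e)) = - c (.inl (b e)) / 4 := by
    intro v₀
    obtain ⟨u, hu₀, hu⟩ := h.exists_alternating v₀
    refine ⟨Sum.elim u (Sum.elim (fun e => - u (a e) / 4) fun e => - u (b e) / 4), h.inj ?_, hu₀,
      fun _ => rfl, fun _ => rfl⟩
    ext e m
    obtain ⟨h0, h1, h2⟩ := h.ev_comb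
      (Sum.elim u (Sum.elim (fun e => - u (a e) / 4) fun e => - u (b e) / 4)) e
    rw [map_zero, Pi.zero_apply, Pi.zero_apply]
    rcases fin_three_cases m with rfl | rfl | rfl
    · rw [h0]
      simp only [Sum.elim_inl, Sum.elim_inr]
      ring
    · rw [h1]
      simp only [Sum.elim_inr, Sum.elim_inl]
      linarith [hu e]
    · rw [h2]
      simp only [Sum.elim_inl, Sum.elim_inr]
      ring
  rcases s₀ with v | e | e
  · obtain ⟨c, hc, h1, -⟩ := key v
    exact ⟨c, hc, by rw [h1]; exact one_ne_zero⟩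
  · obtain ⟨c, hc, h1, h2, -⟩ := key (a e)
    exact ⟨c, hc, by rw [h2, h1]; norm_num⟩
  · obtain ⟨c, hc, h1, -, h2⟩ := key (b e)
    exact ⟨c, hc, by rw [h2, h1]; norm_num⟩

/-- Omitting any one function leaves a basis. -/
theorem isBasisFamily (h : GraphSystem a b ev fV fP fM) (s₀ : V ⊕ D ⊕ D) :
    IsBasisFamily (fun s : {s // s ≠ s₀} => Sum.elim fV (Sum.elim fP fM) s.1) := by
  classical
  constructor
  · rw [Fintype.linearIndependent_iff]
    intro c hc s
    let c' : V ⊕ D ⊕ D → ℝ := fun s => if hs : s ≠ s₀ then c ⟨s, hs⟩ else 0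
    have h0 : c' s₀ = 0 := dif_neg (by simp)
    have h1 : ∀ s : {s // s ≠ s₀}, c' s.1 = c s := fun s => dif_pos s.2
    have hc' : comb fV fP fM c' = 0 := by
      rw [comb, Fintype.sum_eq_add_sum_subtype_ne _ s₀, h0, zero_smul, zero_add, ← hc]
      exact Finset.sum_congr rfl fun s _ => by rw [h1]
    rw [← h1, h.kernel hc' h0, Pi.zero_apply]
  · rw [eq_top_iff]
    rintro φ -
    obtain ⟨c, rfl⟩ := h.exists_comb_eq φ
    obtain ⟨d, hd, hd0⟩ := h.exists_kernel s₀
    -- A multiple of the relation `d` removes the coefficient at `s₀` without changing the sum.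
    have : comb fV fP fM c = comb fV fP fM (c - (c s₀ / d s₀) • d) := by
      have e : comb fV fP fM (c - (c s₀ / d s₀) • d) =
          comb fV fP fM c - (c s₀ / d s₀) • comb fV fP fM d := by
        simp only [comb, Pi.sub_apply, Pi.smul_apply, smul_eq_mul, sub_smul, mul_smul,
          Finset.sum_sub_distrib, Finset.smul_sum]
      rw [e, hd, smul_zero, sub_zero]
    rw [this, comb, Fintype.sum_eq_add_sum_subtype_ne _ s₀]
    have e0 : (c - (c s₀ / d s₀) • d) s₀ = 0 := by
      simp [hd0]
    rw [e0, zero_smul, zero_add]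
    exact Submodule.sum_mem _ fun s _ =>
      Submodule.smul_mem _ _ (Submodule.subset_span ⟨s, rfl⟩)

end GraphSystem

end Graph

/-! ### Consequences of having a basis, and finiteness of the mesh -/

lemma IsBasisFamily.isBasisSet {κ W : Type*} [AddCommGroup W] [Module ℝ W] {f : κ → W}
    (h : IsBasisFamily f) {B : Set W} (hB : B = Set.range f) : IsBasisSet B := by
  subst hB
  exact ⟨h.1.linearIndepOn_id, h.2⟩

lemma IsBasisFamily.finrank {κ W : Type*} [AddCommGroup W] [Module ℝ W] [Finite κ] {f : κ → W}
    (h : IsBasisFamily f) : FiniteDimensional ℝ W ∧ Module.finrank ℝ W = Nat.card κ := by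
  have := Fintype.ofFinite κ
  let b := Module.Basis.mk h.1 h.2.ge
  refine ⟨Module.Finite.of_basis b, ?_⟩
  rw [Module.finrank_eq_nat_card_basis b]

namespace ParallelogramMesh

variable {Ω : Set Plane} {ι : Type*}

lemma finite_vertices [Finite ι] (M : ParallelogramMesh Ω ι) : M.vertices.Finite := by
  refine (Set.finite_range fun p : ι × Fin 4 => M.vert p.1 p.2).subset ?_
  rintro _ ⟨i, k, rfl⟩
  exact ⟨(i, k), rfl⟩

lemma finite_edges [Finite ι] (M : ParallelogramMesh Ω ι) : M.edges.Finite := by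
  refine (Set.finite_range fun p : ι × Fin 4 => M.edge p.1 p.2).subset ?_
  rintro _ ⟨i, k, rfl⟩
  exact ⟨(i, k), rfl⟩

lemma nonempty_of_domain (M : ParallelogramMesh Ω ι) (hΩ : IsParallelogramDomain Ω) : Nonempty ι := by
  obtain ⟨f, -, -, hf⟩ := hΩ.exists_param
  have : f 0 ∈ ⋃ i, M.F i '' refSquare := M.cover ▸ hf ▸ Set.mem_range_self 0
  obtain ⟨i, -⟩ := Set.mem_iUnion.1 this
  exact ⟨i⟩

end ParallelogramMesh

end CubicNC

end

/-! ### The theorem: the mesh as a graph system -/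

open CubicNC CubicNC.ParallelogramMesh in
theorem mainTheorem3 {Ω : Set CubicNC.Plane} (hΩ : CubicNC.IsParallelogramDomain Ω)
    {ι : Type*} [Finite ι] (M : CubicNC.ParallelogramMesh Ω ι)
    (γ : Fin M.numGauss ≃ M.gaussPoints) :
    FiniteDimensional ℝ M.NC ∧
    (Module.finrank ℝ M.NC : ℤ) = M.numVertices + 2 * M.numEdges - 1 ∧
    ∃ (φV : M.vertices → M.NC) (φP φM : M.edges → M.NC),
      -- the functions with the prescribed Gauss values exist and are unique
      (∀ (v : M.vertices) (ψ : M.NC), M.HasGaussValues ψ (M.vertexValues v) ↔ ψ = φV v) ∧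
      (∀ (E : M.edges) (ψ : M.NC), M.HasGaussValues ψ (M.plusValues γ E) ↔ ψ = φP E) ∧
      (∀ (E : M.edges) (ψ : M.NC), M.HasGaussValues ψ (M.minusValues γ E) ↔ ψ = φM E) ∧
      -- omitting any one of all these functions leaves a basis
      (∀ s₀ : M.vertices ⊕ M.edges ⊕ M.edges,
        CubicNC.IsBasisFamily
          (fun s : {s // s ≠ s₀} => Sum.elim φV (Sum.elim φP φM) s.1)) ∧
      -- in particular the three sets are bases
      (∀ v₀, CubicNC.IsBasisSet (φV '' {v | v ≠ v₀} ∪ Set.range φP ∪ Set.range φM)) ∧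
      (∀ E₀, CubicNC.IsBasisSet (Set.range φV ∪ φP '' {E | E ≠ E₀} ∪ Set.range φM)) ∧
      (∀ E₀, CubicNC.IsBasisSet (Set.range φV ∪ Set.range φP ∪ φM '' {E | E ≠ E₀})) := by
  classical
  have := M.finite_vertices.to_subtype
  have := M.finite_edges.to_subtype
  have := Fintype.ofFinite M.vertices
  have := Fintype.ofFinite M.edges
  obtain ⟨i₀⟩ := M.nonempty_of_domain hΩ
  let v₀ : M.vertices := ⟨_, M.vert_mem_vertices i₀ 0⟩
  -- Each edge is oriented so that its plus point is the Gauss point next to `a`, and a cell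
  -- containing it is fixed for evaluation.
  choose a b ic hab ha hb hic hor using fun E : M.edges => exists_orientation γ E.2
  have hE : ∀ E, segment ℝ (a E) (b E) ∈ M.edges := fun E => hab E ▸ E.2
  have hplus : ∀ E : M.edges, M.plusValues γ E = edgeValues E (gaussPt (a E) (b E) 0) := by
    intro E
    ext g
    simp only [plusValues, edgeValues, (hor E g).1]
  have hminus : ∀ E : M.edges, M.minusValues γ E = edgeValues E (gaussPt (a E) (b E) 2) := by
    intro E
    ext g
    simp only [minusValues, edgeValues, (hor E g).2]
  choose φV hφV using fun v : M.vertices => exists_hasGaussValues_vertexValues (M := M) v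
  have hP : ∀ E : M.edges, ∃ φ : M.NC, M.HasGaussValues φ (M.plusValues γ E) := fun E => by
    rw [hplus, hab E]
    exact exists_hasGaussValues_edgeValues (hE E) (by decide)
  have hM : ∀ E : M.edges, ∃ φ : M.NC, M.HasGaussValues φ (M.minusValues γ E) := fun E => by
    rw [hminus, hab E]
    exact exists_hasGaussValues_edgeValues (hE E) (by decide)
  choose φP hφP using hP
  choose φM hφM using hM
  have hcell : ∀ E m, gaussPt (a E) (b E) m ∈ M.cell (ic E) := fun E m =>
    hic E (hab E ▸ gaussPt_mem _ _ _)
  let ev : M.NC →ₗ[ℝ] (M.edges → Fin 3 → ℝ) :=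
    { toFun φ := fun E m => φ.1 (ic E) ⟨gaussPt (a E) (b E) m, hcell E m⟩
      map_add' _ _ := rfl
      map_smul' _ _ := rfl }
  have hev : ∀ {φ w}, M.HasGaussValues φ w → ∀ E m, ev φ E m = w (gaussPt (a E) (b E) m) :=
    fun h E m => h _ (gaussPt_mem_gaussPoints (hE E) m) _ _
  have hedge : ∀ (E E' : M.edges) (n m : Fin 3),
      edgeValues E (gaussPt (a E) (b E) n) (gaussPt (a E') (b E') m) =
      if E = E' then (if m = 1 then 5 else if m = n then 4 else 0) else 0 := by
    intro E E' n m
    by_cases h : E = E'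
    · subst h
      rw [if_pos rfl, ← edgeValues_self (hE E), ← hab E]
    · have h' : segment ℝ (a E) (b E) ≠ segment ℝ (a E') (b E') := fun e =>
        h (Subtype.ext ((hab E).trans (e.trans (hab E').symm)))
      rw [if_neg h, hab E, edgeValues_gaussPt (hE E) (hE E'), if_neg h']
  have hsys : GraphSystem (fun E => (⟨a E, ha E⟩ : M.vertices)) (fun E => ⟨b E, hb E⟩)
      ev φV φP φM := by
    refine ⟨?_, ?_, ?_, ?_, ?_, ?_, ?_⟩
    · intro φ ψ h
      obtain ⟨w, hw⟩ := exists_hasGaussValues φ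
      obtain ⟨w', hw'⟩ := exists_hasGaussValues ψ
      refine HasGaussValues.ext fun i k m => ?_
      rw [hasGaussValues_iff.1 hw, hasGaussValues_iff.1 hw', gauss_eq_gaussPt]
      let E : M.edges := ⟨_, M.edge_mem_edges i k⟩
      have key : ∀ m, w (gaussPt (a E) (b E) m) = w' (gaussPt (a E) (b E) m) := fun m => by
        rw [← hev hw, ← hev hw', h]
      -- The chosen orientation may be opposite to that of the cell, which reverses the Gauss
      -- points.
      rcases segment_eq_segment (hab E) with ⟨h1, h2⟩ | ⟨h1, h2⟩
      · rw [h1, h2]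
        exact key m
      · rw [h1, h2, gaussPt_swap]
        exact key _
    · intro v E m
      rw [hev (hφV v), vertexValues_gaussPt (hE E)]
      simp only [Subtype.ext_iff]
    · intro E E' m
      rw [hev (hφP E), hplus, hedge]
      congr
    · intro E E' m
      rw [hev (hφM E), hminus, hedge]
      congr
    · intro φ
      obtain ⟨w, hw⟩ := exists_hasGaussValues φ
      obtain ⟨u, hu⟩ := hw.exists_vertex_values hΩ v₀.2
      refine ⟨fun v => u v, fun E => ?_⟩
      rw [hu _ _ (hE E)]
      congr 1
      ext m
      rw [hev hw]
    · intro v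
      obtain ⟨u, hu, hu'⟩ := exists_alternating hΩ v.2
      exact ⟨fun v => u v, hu, fun E => hu' _ _ (hE E)⟩
    · intro u hu v hv
      -- Extension by zero off the vertices, where the values are never used.
      let u' : Plane → ℝ := fun p => if h : p ∈ M.vertices then u ⟨p, h⟩ else 0
      have hu' : ∀ v : M.vertices, u' v = u v := fun v => dif_pos v.2
      have halt : ∀ i k, u' (M.vert i k) + u' (M.vert i (k + 1)) = 0 := by
        intro i k
        let E : M.edges := ⟨_, M.edge_mem_edges i k⟩
        have := hu E
        rw [← hu', ← hu'] at this
        rcases segment_eq_segment (hab E) with ⟨h1, h2⟩ | ⟨h1, h2⟩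
        · rw [h1, h2]
          exact this
        · rw [h1, h2, add_comm]
          exact this
      ext x
      rw [← hu', Pi.zero_apply]
      exact eq_zero_of_alternating hΩ halt v.2 ((hu' v).trans hv) x.2
  have hbasis := hsys.isBasisFamily
  obtain ⟨hfin, hrank⟩ := (hbasis (.inl v₀)).finrank
  refine ⟨hfin, ?_, φV, φP, φM, ?_, ?_, ?_, hbasis, ?_, ?_, ?_⟩
  · have hcard : Nat.card {s : M.vertices ⊕ M.edges ⊕ M.edges // s ≠ .inl v₀} + 1 =
        M.numVertices + (M.numEdges + M.numEdges) := by
      rw [numVertices, numEdges, ← Nat.card_coe_set_eq, ← Nat.card_coe_set_eq, ← Nat.card_sum,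
        ← Nat.card_sum, Nat.card_eq_fintype_card, Nat.card_eq_fintype_card,
        Fintype.card_subtype_compl, Fintype.card_subtype_eq]
      exact Nat.sub_add_cancel (Fintype.card_pos_iff.2 ⟨.inl v₀⟩)
    rw [← hrank] at hcard
    omega
  · exact fun v ψ => ⟨fun h => h.unique (hφV v), fun h => h ▸ hφV v⟩
  · exact fun v ψ => ⟨fun h => h.unique (hφP v), fun h => h ▸ hφP v⟩
  · exact fun v ψ => ⟨fun h => h.unique (hφM v), fun h => h ▸ hφM v⟩
  · intro v
    refine (hbasis (.inl v)).isBasisSet ?_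
    ext x
    simp [or_assoc]
  · intro E
    refine (hbasis (.inr (.inl E))).isBasisSet ?_
    ext x
    simp [or_assoc]
  · intro E
    refine (hbasis (.inr (.inr E))).isBasisSet ?_
    ext x
    simp [or_assoc]
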